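/- Let $n$ be an integer of the form $2$, $4$, $p^m$ or $2p^m$ with $p$ an odd prime and $m\ge 1$, put $d=\varphi(n)$, and let $\zeta$ be a primitive $n$-th root of unity. Let $\otimes$ be the multiplication on $\mathbb Z^d$ obtained from that of $\mathbb Z[\zeta]=\mathbb Z\oplus\mathbb Z\zeta\oplus\dots\oplus\mathbb Z\zeta^{d-1}$ through the isomorphism $\psi:\mathbb Z^d\to\mathbb Z[\zeta]$, $\psi(x)=\sum_{i<d}x_i\zeta^i$, i.e. $\psi(r\otimes u)=\psi(r)\psi(u)$; denote by the same symbol its $\mathbb R$-bilinear extension to $\mathbb R^d$. For a finite set $U\subset\mathbb Z^d$, a $U$-pattern in $\mathbb Z^d$ (resp. $\mathbb R^d$) with basepoint $x$ is a set $\{x+r\otimes u: u\in U\}$ with $x,r\in\mathbb Z^d$ (resp. $\mathbb R^d$) and $r\neq 0$. Write $[N]=\{1,\dots,N\}$, and let $\dim_M$ be the Minkowski (upper box) dimension. Consider sequences $(U_k)_{k\in\mathbb N}$ of sets $U_k\subset\mathbb Z^d$ with $|U_k|=k$, such that no $u\in U_k$ has a coordinate equal to $0$ and $\max_{u\in U_k}\|u\|_\infty\le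 2^{o(k)}$ as $k\to\infty$. (1) There is an absolute constant $c>0$ such that for every such $n$ and every such sequence $(U_k)$, for all sufficiently large $k$ (depending on $n$ and the sequence) and all sufficiently large $N$ (depending on $n$, the sequence and $k$), there is a finite set $B\subset\mathbb Z^d$ which contains a $U_k$-pattern with basepoint $x$ for every $x\in[N]^d$ and satisfies $$|B|<N^{\,d-c/\log k}.$$ (2) There is an absolute constant $c>0$ such that for every such $n$ and every such sequence $(U_k)$, for all sufficiently large $k$, there is a compact set $F\subset\mathbb R^d$ which contains a $U_k$-pattern with basepoint $x$ for every $x\in[0,1]^d$ and satisfies $$\dim_M F=d-\frac{c}{\log k}.$$ (3) Let $G'_k(N)$ be the size of the smallest set of integers that contains, for $N$ distinct integers $x$, an arithmetic progression $x+r,x+2r,\dots,x+kr$ with some integer $r\ne0$. There is an absolute constant $c>0$ such that for every $k\ge2$ and all sufficiently large $N$ (depending on $k$), $$G'_k(N)\le N^{1-c/\log k}.$$ -/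

import Mathlib

open Filter Topology Asymptotics Polynomial

/-- The polynomial `x₀ + x₁ X + ⋯ + x_{d-1} X^{d-1}` with coefficient vector `x`. -/
noncomputable def coordPoly {R : Type*} [CommRing R] {d : ℕ} (x : Fin d → R) : R[X] :=
  ∑ i, C (x i) * X ^ (i : ℕ)

/-- The multiplication `r ⊗ u` on `R ^ φ(n)`: multiply `r` and `u` as elements of
`R[ζ] = R[X] / (Φ_n)` in the basis `1, ζ, …, ζ^{φ(n)-1}` and read off the coordinates in that basis.
For `R = ℤ` this is multiplication in `ℤ[ζ_n] ≅ ℤ ^ φ(n)` (see `zetaCoord_cycloMul`,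
`zetaCoord_injective`, `range_zetaCoord`); for `R = ℝ` it is its `ℝ`-bilinear extension. -/
noncomputable def cycloMul (n : ℕ) {R : Type*} [CommRing R] (r u : Fin n.totient → R) :
    Fin n.totient → R :=
  fun l => ((coordPoly r * coordPoly u) %ₘ cyclotomic n R).coeff (l : ℕ)

/-- The natural map `ψ : (x₀, …, x_{d-1}) ↦ x₀ + x₁ ζ + ⋯ + x_{d-1} ζ^{d-1}`. -/
def zetaCoord {R A : Type*} [CommRing R] [CommRing A] [Algebra R A] {d : ℕ} (ζ : A)
    (x : Fin d → R) : A :=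
  ∑ i, algebraMap R A (x i) * ζ ^ (i : ℕ)

/-- The set `B ⊆ R ^ φ(n)` contains a `U`-pattern `x + r ⊗ U` with basepoint `x`, for some nonzero
scaling factor `r ∈ R ^ φ(n)` (used for `R = ℤ` and `R = ℝ`). -/
def ContainsPattern (n : ℕ) {R : Type*} [CommRing R] (U : Finset (Fin n.totient → ℤ))
    (B : Set (Fin n.totient → R)) (x : Fin n.totient → R) : Prop :=
  ∃ r : Fin n.totient → R, r ≠ 0 ∧ ∀ u ∈ U, x + cycloMul n r (fun i => (u i : R)) ∈ B

/-- The smallest positive number of axis-parallel closed cubes of side length `ε` that cover `E`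
(for bounded `E`). -/
noncomputable def boxCount {d : ℕ} (E : Set (Fin d → ℝ)) (ε : ℝ) : ℕ :=
  sInf {m : ℕ | 0 < m ∧ ∃ a : Fin m → (Fin d → ℝ),
    E ⊆ ⋃ j, Set.Icc (a j) (fun i => a j i + ε)}

/-- The Minkowski (upper box) dimension of a bounded set `E ⊆ ℝ^d`. -/
noncomputable def minkowskiDim {d : ℕ} (E : Set (Fin d → ℝ)) : EReal :=
  limsup (fun ε : ℝ => ((Real.log (boxCount E ε) / Real.log (1 / ε) : ℝ) : EReal)) (𝓝[>] 0)

/-- The set `B` of integers contains a `k`-term arithmetic progression `x + r, …, x + k r` with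
basepoint `x` and nonzero common difference `r`. -/
def ContainsAP (k : ℕ) (B : Set ℤ) (x : ℤ) : Prop :=
  ∃ r : ℤ, r ≠ 0 ∧ ∀ i ∈ Finset.Icc 1 k, x + (i : ℤ) * r ∈ B

/-- `G'_k(N)`: the size of the smallest set of integers that contains a `k`-term arithmetic
progression with basepoint `x` for `N` distinct integers `x`. -/
noncomputable def gPrime (k N : ℕ) : ℕ :=
  sInf {m : ℕ | ∃ B S : Finset ℤ, B.card = m ∧ S.card = N ∧ ∀ x ∈ S, ContainsAP k (B : Set ℤ) x}

/-- The minimum in the definition of `gPrime` is attained. -/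
theorem gPrime_spec (k N : ℕ) : ∃ B S : Finset ℤ, B.card = gPrime k N ∧ S.card = N ∧
    ∀ x ∈ S, ContainsAP k (B : Set ℤ) x := by
  refine Nat.sInf_mem (s := {m : ℕ | ∃ B S : Finset ℤ, B.card = m ∧ S.card = N ∧
    ∀ x ∈ S, ContainsAP k (B : Set ℤ) x}) ?_
  refine ⟨_, Finset.Icc (1 : ℤ) (N + k), Finset.Icc (1 : ℤ) N, rfl, by simp, ?_⟩
  intro x hx
  refine ⟨1, one_ne_zero, fun i hi => ?_⟩
  simp only [Finset.mem_Icc, Finset.coe_Icc, Set.mem_Icc] at *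
  omega

theorem coordPoly_degree_lt {R : Type*} [CommRing R] {d : ℕ} (x : Fin d → R) :
    (coordPoly x).degree < d :=
  lt_of_le_of_lt (degree_sum_le _ _) ((Finset.sup_lt_iff (WithBot.bot_lt_coe d)).2 fun i _ =>
    lt_of_le_of_lt (degree_C_mul_X_pow_le _ _) (WithBot.coe_lt_coe.2 i.2))

theorem coordPoly_coeff {R : Type*} [CommRing R] {d : ℕ} (x : Fin d → R) (l : Fin d) :
    (coordPoly x).coeff (l : ℕ) = x l := by
  simp [coordPoly, coeff_C_mul, coeff_X_pow, Fin.val_inj]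

theorem coordPoly_of_degree_lt {R : Type*} [CommRing R] {d : ℕ} (p : R[X]) (hp : p.degree < d) :
    coordPoly (fun l : Fin d => p.coeff (l : ℕ)) = p := by
  ext m
  by_cases hm : m < d
  · exact coordPoly_coeff (fun l : Fin d => p.coeff (l : ℕ)) ⟨m, hm⟩
  · have hdm : (d : WithBot ℕ) ≤ m := by exact_mod_cast not_lt.1 hm
    rw [coeff_eq_zero_of_degree_lt ((coordPoly_degree_lt _).trans_le hdm),
      coeff_eq_zero_of_degree_lt (hp.trans_le hdm)]

theorem aeval_coordPoly {R A : Type*} [CommRing R] [CommRing A] [Algebra R A] {d : ℕ} (ζ : A)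
    (x : Fin d → R) : aeval ζ (coordPoly x) = zetaCoord ζ x := by
  simp [coordPoly, zetaCoord]

/-- `ψ(r ⊗ u) = ψ(r) ψ(u)`. -/
theorem zetaCoord_cycloMul (n : ℕ) {R A : Type*} [CommRing R] [Nontrivial R] [CommRing A]
    [Algebra R A] (ζ : A) (hζ : aeval ζ (cyclotomic n R) = 0) (r u : Fin n.totient → R) :
    zetaCoord ζ (cycloMul n r u) = zetaCoord ζ r * zetaCoord ζ u := by
  have hm := cyclotomic.monic n R
  have hd := degree_modByMonic_lt (coordPoly r * coordPoly u) hm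
  rw [degree_cyclotomic] at hd
  have he : coordPoly (cycloMul n r u) = (coordPoly r * coordPoly u) %ₘ cyclotomic n R :=
    coordPoly_of_degree_lt _ hd
  rw [← aeval_coordPoly, he,
    aeval_modByMonic_eq_self_of_root hζ, map_mul, aeval_coordPoly, aeval_coordPoly]

/-- `ψ : ℤ ^ φ(n) → ℤ[ζ]` is injective for a primitive `n`-th root of unity `ζ`. -/
theorem zetaCoord_injective {n : ℕ} (hn : 0 < n) {ζ : ℂ} (hζ : IsPrimitiveRoot ζ n) :
    Function.Injective (zetaCoord ζ : (Fin n.totient → ℤ) → ℂ) := by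
  intro x y hxy
  rw [← aeval_coordPoly, ← aeval_coordPoly] at hxy
  have h0 : aeval ζ (coordPoly x - coordPoly y) = 0 := by rw [map_sub, hxy, sub_self]
  have hdvd : cyclotomic n ℤ ∣ coordPoly x - coordPoly y := by
    rw [cyclotomic_eq_minpoly hζ hn]
    exact minpoly.isIntegrallyClosed_dvd (hζ.isIntegral hn) h0
  have hlt : (coordPoly x - coordPoly y).degree < (cyclotomic n ℤ).degree := by
    rw [degree_cyclotomic]
    exact lt_of_le_of_lt (degree_sub_le _ _)
      (max_lt (coordPoly_degree_lt x) (coordPoly_degree_lt y))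
  have hz := Polynomial.eq_zero_of_dvd_of_degree_lt hdvd hlt
  funext l
  rw [← coordPoly_coeff x l, ← coordPoly_coeff y l, sub_eq_zero.1 hz]

/-- The image of `ψ : ℤ ^ φ(n) → ℂ` is the ring `ℤ[ζ]`. -/
theorem range_zetaCoord {n : ℕ} (hn : 0 < n) {ζ : ℂ} (hζ : IsPrimitiveRoot ζ n) :
    Set.range (zetaCoord ζ : (Fin n.totient → ℤ) → ℂ) = Algebra.adjoin ℤ {ζ} := by
  have hroot : aeval ζ (cyclotomic n ℤ) = 0 := by
    rw [cyclotomic_eq_minpoly hζ hn]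
    exact minpoly.aeval ℤ ζ
  ext z
  rw [Algebra.adjoin_singleton_eq_range_aeval]
  constructor
  · rintro ⟨x, rfl⟩
    exact ⟨coordPoly x, aeval_coordPoly ζ x⟩
  · rintro ⟨p, rfl⟩
    have hd := degree_modByMonic_lt p (cyclotomic.monic n ℤ)
    rw [degree_cyclotomic] at hd
    refine ⟨fun l => (p %ₘ cyclotomic n ℤ).coeff (l : ℕ), ?_⟩
    rw [← aeval_coordPoly, coordPoly_of_degree_lt _ hd]
    exact aeval_modByMonic_eq_self_of_root hroot

/-! The scaling factor may depend on the basepoint, and the idea is to let it be congruent to x ⊗ x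
modulo many primes. For an odd prime q not dividing the norm of u, x + x ⊗ x ⊗ u modulo q is
unchanged under x ↦ -x - u⁻¹, so it takes at most two thirds of the residues (`card_quadValues_le`).
With k such primes of product Q, the Chinese remainder theorem confines x + r ⊗ u to a proportion
about (2/3)^k of a box (`card_le_of_residues`).

The norms of the elements of U_k are nonzero and their product has at most k³ prime factors, while
there are at least k⁴ primes up to k⁵. Hence k admissible primes exist and log Q ≤ 5k log k. A base
W comparable to Q up to a factor 2^k and constants also has log W = O(k log k), so the gain (2/3)^k
is a power W^(-c / log k), even after boundary constants are paid (`eventually_digitSystem`).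

This single-scale saving becomes a power saving at all scales through base W expansions. The
multiplication is linear in r, so choosing r digit by digit makes x + r ⊗ u a base W combination of
single-digit values: at most W^s choices per digit (`DigitSystem.add_factor_mem_values`,
`DigitSystem.card_values_le`). Finitely many digits give the discrete statement; its case n = 2, U_k
= {1, …, k} gives progressions for large k, and monotonicity in k treats the rest. Infinitely many
digits give a real scaling factor and an upper box bound for the resulting set; a Cantor set of
exact dimension s is added to turn the bound into an equality (`DigitSystem.exists_compact`). -/

/-! ### Structure constants and size bounds for the multiplication -/

/-- The structure constants of `cycloMul` in the basis `1, ζ, …, ζ^{φ(n)-1}`. -/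
noncomputable def cycloConst (n : ℕ) (i j l : Fin n.totient) : ℤ :=
  ((X ^ ((i : ℕ) + j) : ℤ[X]) %ₘ cyclotomic n ℤ).coeff l

/-- Since Φ_n is monic with integer coefficients, division by it commutes with base change from ℤ.
The same integer constants therefore serve ℤ, `ZMod q` and ℝ, which makes the product bilinear and
compatible with reductions and casts. -/
theorem cycloMul_apply (n : ℕ) {R : Type*} [CommRing R] (r u : Fin n.totient → R)
    (l : Fin n.totient) :
    cycloMul n r u l = ∑ i, ∑ j, r i * u j * (cycloConst n i j l : R) := by
  have hX : ∀ m : ℕ, (((X ^ m : R[X]) %ₘ cyclotomic n R).coeff l : R) =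
      (((X ^ m : ℤ[X]) %ₘ cyclotomic n ℤ).coeff l : ℤ) := by
    intro m
    have h := map_modByMonic (p := (X ^ m : ℤ[X])) (Int.castRingHom R) (cyclotomic.monic n ℤ)
    rw [map_cyclotomic_int, Polynomial.map_pow, map_X] at h
    rw [← h, coeff_map, eq_intCast]
  have hp : coordPoly r * coordPoly u =
      ∑ i, ∑ j, (r i * u j) • (X ^ ((i : ℕ) + j) : R[X]) := by
    rw [coordPoly, coordPoly, Finset.sum_mul_sum]
    refine Finset.sum_congr rfl fun i _ => Finset.sum_congr rfl fun j _ => ?_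
    rw [smul_eq_C_mul, C_mul, pow_add]
    ring
  change (modByMonicHom (cyclotomic n R) (coordPoly r * coordPoly u)).coeff l = _
  rw [hp, map_sum, finsetSum_coeff]
  refine Finset.sum_congr rfl fun i _ => ?_
  rw [map_sum, finsetSum_coeff]
  refine Finset.sum_congr rfl fun j _ => ?_
  rw [map_smul, coeff_smul, smul_eq_mul, modByMonicHom_apply, hX, cycloConst]

theorem cycloMul_comm (n : ℕ) {R : Type*} [CommRing R] (r u : Fin n.totient → R) :
    cycloMul n r u = cycloMul n u r := by
  funext l
  simp only [cycloMul, mul_comm (coordPoly r)]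

theorem cycloMul_map (n : ℕ) {R S : Type*} [CommRing R] [CommRing S] (f : R →+* S)
    (r u : Fin n.totient → R) :
    cycloMul n (fun i => f (r i)) (fun i => f (u i)) = fun i => f (cycloMul n r u i) := by
  funext l
  simp [cycloMul_apply]

theorem cycloMul_intCast (n : ℕ) (R : Type*) [CommRing R] (r u : Fin n.totient → ℤ) :
    cycloMul n (fun i => (r i : R)) (fun i => (u i : R)) = fun i => ((cycloMul n r u i : ℤ) : R) := by
  simpa using cycloMul_map n (Int.castRingHom R) r u

/-- Multiplication by `u` as a linear map. -/
noncomputable def cycloLin (n : ℕ) {R : Type*} [CommRing R] (u : Fin n.totient → R) :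
    (Fin n.totient → R) →ₗ[R] (Fin n.totient → R) where
  toFun r := cycloMul n r u
  map_add' r s := by
    funext l
    simp [cycloMul_apply, add_mul, Finset.sum_add_distrib]
  map_smul' a r := by
    funext l
    simp [cycloMul_apply, Finset.mul_sum, mul_assoc]

theorem cycloLin_apply (n : ℕ) {R : Type*} [CommRing R] (u r : Fin n.totient → R) :
    cycloLin n u r = cycloMul n r u := rfl

theorem exists_cycloMul_bound (n : ℕ) : ∃ C : ℕ, 1 ≤ C ∧ ∀ (r u : Fin n.totient → ℤ) (a b : ℤ),
    (∀ i, |r i| ≤ a) → (∀ i, |u i| ≤ b) → ∀ l, |cycloMul n r u l| ≤ C * a * b := by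
  refine ⟨1 + ∑ l, ∑ i, ∑ j, (cycloConst n i j l).natAbs, by omega, ?_⟩
  intro r u a b hr hu l
  have ha : 0 ≤ a := (abs_nonneg _).trans (hr l)
  have hb : 0 ≤ b := (abs_nonneg _).trans (hu l)
  have h1 : |cycloMul n r u l| ≤ ∑ i, ∑ j, a * b * |cycloConst n i j l| := by
    rw [cycloMul_apply]
    refine (Finset.abs_sum_le_sum_abs _ _).trans (Finset.sum_le_sum fun i _ => ?_)
    refine (Finset.abs_sum_le_sum_abs _ _).trans (Finset.sum_le_sum fun j _ => ?_)
    rw [abs_mul, abs_mul, Int.cast_id]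
    exact mul_le_mul_of_nonneg_right (mul_le_mul (hr i) (hu j) (abs_nonneg _) ha) (abs_nonneg _)
  have h2 : ∑ i, ∑ j, |cycloConst n i j l| ≤ ∑ l, ∑ i, ∑ j, |cycloConst n i j l| :=
    Finset.single_le_sum (f := fun l => ∑ i, ∑ j, |cycloConst n i j l|)
      (fun _ _ => Finset.sum_nonneg fun _ _ => Finset.sum_nonneg fun _ _ => abs_nonneg _)
      (Finset.mem_univ l)
  refine h1.trans ?_
  simp_rw [← Finset.mul_sum]
  push_cast
  nlinarith [mul_nonneg ha hb, mul_le_mul_of_nonneg_left h2 (mul_nonneg ha hb)]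

/-! ### The quadratic map modulo a prime -/

/-- A monic polynomial divides no nonzero polynomial of smaller degree. This allows identities for ⊗
over `ZMod q` to be checked as commutative ring identities in R[X] / (Φ_n). -/
theorem zetaCoord_root_injective (n : ℕ) {R : Type*} [CommRing R] [Nontrivial R] :
    Function.Injective (zetaCoord (AdjoinRoot.root (cyclotomic n R)) :
      (Fin n.totient → R) → AdjoinRoot (cyclotomic n R)) := by
  intro x y hxy
  rw [← aeval_coordPoly, ← aeval_coordPoly, AdjoinRoot.aeval_eq, AdjoinRoot.aeval_eq,
    AdjoinRoot.mk_eq_mk] at hxy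
  have hlt : (coordPoly x - coordPoly y).degree < (cyclotomic n R).degree := by
    rw [degree_cyclotomic]
    exact lt_of_le_of_lt (degree_sub_le _ _)
      (max_lt (coordPoly_degree_lt x) (coordPoly_degree_lt y))
  have hz : coordPoly x - coordPoly y = 0 := by
    by_contra h
    exact (cyclotomic.monic n R).not_dvd_of_degree_lt h hlt hxy
  funext l
  rw [← coordPoly_coeff x l, ← coordPoly_coeff y l, sub_eq_zero.1 hz]

/-- The coordinate vector of `1`. -/
def cycloOne {n : ℕ} (hn : 0 < n) (R : Type*) [CommRing R] : Fin n.totient → R :=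
  Pi.single ⟨0, Nat.totient_pos.2 hn⟩ 1

theorem zetaCoord_cycloOne {n : ℕ} (hn : 0 < n) {R A : Type*} [CommRing R] [CommRing A]
    [Algebra R A] (ζ : A) : zetaCoord ζ (cycloOne hn R) = 1 := by
  rw [zetaCoord, Finset.sum_eq_single ⟨0, Nat.totient_pos.2 hn⟩]
  · simp [cycloOne]
  · intro b _ hb
    simp [cycloOne, hb]
  · simp

/-- The map `x ↦ x + u ⊗ x ⊗ x` is invariant under `x ↦ -x - u⁻¹`. -/
theorem quadratic_invariant {n : ℕ} (hn : 0 < n) {R : Type*} [CommRing R] [Nontrivial R]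
    (u v x : Fin n.totient → R) (huv : cycloMul n u v = cycloOne hn R) :
    (-x - v) + cycloMul n (cycloMul n (-x - v) (-x - v)) u = x + cycloMul n (cycloMul n x x) u := by
  have hroot : aeval (AdjoinRoot.root (cyclotomic n R)) (cyclotomic n R) = 0 := by
    rw [AdjoinRoot.aeval_eq, AdjoinRoot.mk_self]
  apply zetaCoord_root_injective n
  set ζ := AdjoinRoot.root (cyclotomic n R)
  have hadd : ∀ a b : Fin n.totient → R, zetaCoord ζ (a + b) = zetaCoord ζ a + zetaCoord ζ b := by
    intro a b
    simp [zetaCoord, add_mul, Finset.sum_add_distrib]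
  have hsub : ∀ a b : Fin n.totient → R, zetaCoord ζ (a - b) = zetaCoord ζ a - zetaCoord ζ b := by
    intro a b
    simp [zetaCoord, sub_mul, Finset.sum_sub_distrib]
  have hneg : ∀ a : Fin n.totient → R, zetaCoord ζ (-a) = -zetaCoord ζ a := by
    intro a
    simp [zetaCoord]
  have h := congrArg (zetaCoord ζ) huv
  rw [zetaCoord_cycloMul n ζ hroot, zetaCoord_cycloOne] at h
  simp only [hadd, hsub, hneg, zetaCoord_cycloMul n ζ hroot]
  -- The difference of the two sides factors as (uv - 1)(2x + v).
  linear_combination (2 * zetaCoord ζ x + zetaCoord ζ v) * h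

/-- Away from a, the points x and σ x are distinct and share a fibre, so those fibres have at least
two elements; a itself contributes at most one more value. -/
theorem two_mul_card_image_le {α β : Type*} [Fintype α] [DecidableEq α] [DecidableEq β]
    (f : α → β) (σ : α → α) (a : α) (hf : ∀ x, f (σ x) = f x) (hσa : ∀ x, σ x = a → x = a)
    (hσ : ∀ x, σ x = x → x = a) :
    2 * (Finset.univ.image f).card ≤ Fintype.card α + 1 := by
  have h1 : Finset.univ.image f ⊆ insert (f a) ((Finset.univ.erase a).image f) := by
    intro y hy
    obtain ⟨x, -, rfl⟩ := Finset.mem_image.1 hy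
    by_cases hx : x = a
    · simp [hx]
    · exact Finset.mem_insert_of_mem
        (Finset.mem_image_of_mem _ (Finset.mem_erase.2 ⟨hx, Finset.mem_univ _⟩))
  have h2 : 2 * ((Finset.univ.erase a).image f).card ≤ (Finset.univ.erase a).card := by
    refine Finset.mul_card_image_le_card _ _ fun y hy => ?_
    obtain ⟨x, hx, rfl⟩ := Finset.mem_image.1 hy
    have hxa := Finset.ne_of_mem_erase hx
    refine Finset.one_lt_card.2 ⟨x, ?_, σ x, ?_, fun h => hxa (hσ x h.symm)⟩
    · simp [hxa]
    · simpa [hf] using fun h => hxa (hσa x h)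
  have h3 := (Finset.card_le_card h1).trans (Finset.card_insert_le _ _)
  have h4 : (Finset.univ.erase a).card + 1 = Fintype.card α := by
    rw [Finset.card_erase_add_one (Finset.mem_univ a), Finset.card_univ]
  omega

/-- The norm of `u`, as the determinant of the multiplication by `u`. -/
noncomputable def cycloNorm (n : ℕ) (u : Fin n.totient → ℤ) : ℤ :=
  (LinearMap.toMatrix' (cycloLin n u)).det

/-- A vanishing determinant would give r ≠ 0 with r ⊗ u = 0, but ψ embeds the ring in the field ℂ.
-/
theorem cycloNorm_ne_zero {n : ℕ} (hn : 0 < n) {u : Fin n.totient → ℤ} (hu : u ≠ 0) :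
    cycloNorm n u ≠ 0 := by
  intro h
  obtain ⟨r, hr, h0⟩ := Matrix.exists_mulVec_eq_zero_iff.2 h
  rw [LinearMap.toMatrix'_mulVec, cycloLin_apply] at h0
  have hζ := Complex.isPrimitiveRoot_exp n hn.ne'
  set ζ := Complex.exp (2 * Real.pi * Complex.I / n)
  have hroot : aeval ζ (cyclotomic n ℤ) = 0 := by
    rw [cyclotomic_eq_minpoly hζ hn]
    exact minpoly.aeval ℤ ζ
  have hz : zetaCoord ζ (0 : Fin n.totient → ℤ) = 0 := by simp [zetaCoord]
  have hmul := zetaCoord_cycloMul n ζ hroot r u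
  rw [h0, hz] at hmul
  rcases mul_eq_zero.1 hmul.symm with h' | h'
  · exact hr (zetaCoord_injective hn hζ (h'.trans hz.symm))
  · exact hu (zetaCoord_injective hn hζ (h'.trans hz.symm))

theorem exists_cycloNorm_bound (n : ℕ) : ∃ C : ℕ, 1 ≤ C ∧ ∀ (u : Fin n.totient → ℤ) (b : ℕ),
    (∀ i, |u i| ≤ b) → (cycloNorm n u).natAbs ≤ C * b ^ n.totient := by
  obtain ⟨C, hC, h⟩ := exists_cycloMul_bound n
  refine ⟨n.totient.factorial * C ^ n.totient,
    Nat.mul_pos (Nat.factorial_pos _) (pow_pos hC _), fun u b hb => ?_⟩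
  have hdet := Matrix.det_le (A := LinearMap.toMatrix' (cycloLin n u))
    (abv := AbsoluteValue.abs) (x := (C * b : ℤ)) (fun l i => by
      rw [LinearMap.toMatrix'_apply, cycloLin_apply, AbsoluteValue.abs_apply]
      simpa using h (Pi.single i 1) u 1 b (fun j => by
        by_cases hj : j = i
        · subst hj; simp
        · simp [hj]) hb l)
  rw [AbsoluteValue.abs_apply, Fintype.card_fin, nsmul_eq_mul] at hdet
  zify
  rw [cycloNorm]
  refine hdet.trans (le_of_eq ?_)
  ring

/-- Applying the adjugate of the multiplication matrix to 1 gives an integer vector w with w ⊗ u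
equal to the norm times 1; modulo q the norm can be divided out. -/
theorem exists_inverse_zmod {n : ℕ} (hn : 0 < n) (u : Fin n.totient → ℤ) (q : ℕ) [Fact q.Prime]
    (hq : ¬ (q : ℤ) ∣ cycloNorm n u) :
    ∃ v : Fin n.totient → ZMod q, cycloMul n (fun i => (u i : ZMod q)) v = cycloOne hn (ZMod q) := by
  set A := LinearMap.toMatrix' (cycloLin n u)
  set w := A.adjugate.mulVec (cycloOne hn ℤ)
  have hw : cycloMul n w u = cycloNorm n u • cycloOne hn ℤ := by
    rw [← cycloLin_apply, ← LinearMap.toMatrix'_mulVec, Matrix.mulVec_mulVec,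
      Matrix.mul_adjugate, Matrix.smul_mulVec, Matrix.one_mulVec, cycloNorm]
  have hD : (cycloNorm n u : ZMod q) ≠ 0 := by
    rwa [Ne, ZMod.intCast_zmod_eq_zero_iff_dvd]
  refine ⟨(cycloNorm n u : ZMod q)⁻¹ • fun i => (w i : ZMod q), ?_⟩
  rw [cycloMul_comm, ← cycloLin_apply, map_smul, cycloLin_apply, cycloMul_intCast, hw]
  funext i
  have h1 : ((cycloOne hn ℤ i : ℤ) : ZMod q) = cycloOne hn (ZMod q) i := by
    by_cases hi : i = ⟨0, Nat.totient_pos.2 hn⟩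
    · subst hi; simp [cycloOne]
    · simp [cycloOne, hi]
  simp only [Pi.smul_apply, smul_eq_mul, Int.cast_mul, h1]
  rw [inv_mul_cancel_left₀ hD]

/-- The values of `x + u ⊗ x ⊗ x` modulo `q`. -/
noncomputable def quadValues (n : ℕ) (u : Fin n.totient → ℤ) (q : ℕ) [NeZero q] :
    Finset (Fin n.totient → ZMod q) :=
  Finset.univ.image fun x => x + cycloMul n (cycloMul n x x) (fun i => (u i : ZMod q))

theorem card_quadValues_le {n : ℕ} (hn : 0 < n) (u : Fin n.totient → ℤ) (q : ℕ) [Fact q.Prime]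
    (hq2 : q ≠ 2) (hq : ¬ (q : ℤ) ∣ cycloNorm n u) :
    3 * (quadValues n u q).card ≤ 2 * q ^ n.totient := by
  obtain ⟨v, hv⟩ := exists_inverse_zmod hn u q hq
  have hp : q.Prime := Fact.out
  have h2 : (2 : ZMod q) ≠ 0 := by
    intro h
    have : ((2 : ℕ) : ZMod q) = 0 := by exact_mod_cast h
    rw [ZMod.natCast_eq_zero_iff] at this
    exact hq2 ((Nat.prime_dvd_prime_iff_eq hp Nat.prime_two).1 this)
  have hfix : ∀ x : Fin n.totient → ZMod q, -x - v = x → x = -((2 : ZMod q)⁻¹ • v) := by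
    intro x hx
    funext i
    have := congrFun hx i
    simp only [Pi.sub_apply, Pi.neg_apply, Pi.smul_apply, smul_eq_mul] at *
    field_simp
    linear_combination -this
  have hmain := two_mul_card_image_le
    (fun x : Fin n.totient → ZMod q => x + cycloMul n (cycloMul n x x) (fun i => (u i : ZMod q)))
    (fun x => -x - v) (-((2 : ZMod q)⁻¹ • v)) (fun x => quadratic_invariant hn _ v x hv)
    (fun x hx => by
      funext i
      have := congrFun hx i
      simp only [Pi.sub_apply, Pi.neg_apply, Pi.smul_apply, smul_eq_mul] at *
      field_simp at *
      linear_combination -this) hfix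
  have hcard : Fintype.card (Fin n.totient → ZMod q) = q ^ n.totient := by simp [ZMod.card]
  rw [hcard] at hmain
  -- This absorbs the fixed point: (q^d + 1) / 2 is at most 2 q^d / 3 once q^d ≥ 3.
  have h3 : 3 ≤ q ^ n.totient := by
    have : 3 ≤ q := by have := hp.two_le; omega
    exact this.trans (Nat.le_self_pow (Nat.totient_pos.2 hn).ne' q)
  rw [quadValues]
  omega

/-! ### From residue conditions to one digit -/

/-- By the Chinese remainder theorem y is determined by its residues modulo the primes in P and its
quotient by their product Q. Each coordinate of the quotient lies in [-T, 2T), whence the factor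
(3T)^d. -/
theorem card_le_of_residues {d : ℕ} (P : Finset ℕ) (hP : ∀ q ∈ P, q.Prime) (T : ℕ)
    (V : ∀ q : P, Finset (Fin d → ZMod q)) (hV : ∀ q : P, 3 * (V q).card ≤ 2 * (q : ℕ) ^ d)
    (Y : Finset (Fin d → ℤ)) (hYV : ∀ y ∈ Y, ∀ q : P, (fun i => (y i : ZMod q)) ∈ V q)
    (hYT : ∀ y ∈ Y, ∀ i, -(T * (∏ q ∈ P, q : ℕ) : ℤ) ≤ y i ∧
      y i < 2 * (T * (∏ q ∈ P, q : ℕ) : ℤ)) :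
    3 ^ P.card * Y.card ≤ 2 ^ P.card * 3 ^ d * (T * ∏ q ∈ P, q) ^ d := by
  classical
  set Q : ℕ := ∏ q ∈ P, q with hQ
  have hQ0 : 0 < Q := Finset.prod_pos fun q hq => (hP q hq).pos
  have hQZ : (0 : ℤ) < Q := by exact_mod_cast hQ0
  have hcard : Y.card ≤ ((Fintype.piFinset V) ×ˢ
      (Fintype.piFinset fun _ : Fin d => Finset.Ico (-(T : ℤ)) (2 * T))).card := by
    refine Finset.card_le_card_of_injOn
      (fun y => (fun q i => (y i : ZMod q), fun i => y i / (Q : ℤ))) ?_ ?_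
    · intro y hy
      simp only [Finset.coe_product, Set.mem_prod, Finset.mem_coe, Fintype.mem_piFinset,
        Finset.mem_Ico]
      refine ⟨hYV y hy, fun i => ⟨?_, ?_⟩⟩
      · rw [Int.le_ediv_iff_mul_le hQZ]
        have := (hYT y hy i).1
        linarith
      · rw [Int.ediv_lt_iff_lt_mul hQZ]
        have := (hYT y hy i).2
        linarith
    · intro y _ z _ hyz
      simp only [Prod.mk.injEq] at hyz
      funext i
      have h1 : (Q : ℤ) ∣ y i - z i := by
        rw [hQ, Nat.cast_prod]
        refine Finset.prod_dvd_of_coprime ?_ fun q hq => ?_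
        · intro a ha b hb hab
          exact Nat.isCoprime_iff_coprime.2 ((Nat.coprime_primes (hP a ha) (hP b hb)).2 hab)
        · have := congrFun (congrFun hyz.1 ⟨q, hq⟩) i
          simp only at this
          rw [← ZMod.intCast_zmod_eq_zero_iff_dvd, Int.cast_sub, this, sub_self]
      have h2 : y i / (Q : ℤ) = z i / (Q : ℤ) := congrFun hyz.2 i
      have h3 : y i % (Q : ℤ) = z i % (Q : ℤ) :=
        Int.emod_eq_emod_iff_emod_sub_eq_zero.2 (Int.emod_eq_zero_of_dvd h1)
      rw [← Int.mul_ediv_add_emod (y i) Q, ← Int.mul_ediv_add_emod (z i) Q, h2, h3]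
  have hI : (Finset.Ico (-(T : ℤ)) (2 * T)).card = 3 * T := by
    rw [Int.card_Ico]
    omega
  rw [Finset.card_product, Fintype.card_piFinset, Fintype.card_piFinset] at hcard
  simp only [hI, Finset.prod_const, Finset.card_univ, Fintype.card_fin] at hcard
  have hprod : 3 ^ P.card * ∏ q : P, (V q).card ≤ 2 ^ P.card * Q ^ d := by
    have h := Finset.prod_le_prod' (s := Finset.univ) fun (q : P) _ => hV q
    rw [Finset.prod_mul_distrib, Finset.prod_mul_distrib, Finset.prod_const, Finset.prod_const,
      Finset.card_univ, Fintype.card_coe, Finset.prod_pow, Finset.prod_coe_sort P (fun q => q)] at h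
    exact h
  calc 3 ^ P.card * Y.card ≤ 3 ^ P.card * ((∏ q : P, (V q).card) * (3 * T) ^ d) :=
        Nat.mul_le_mul_left _ hcard
    _ = (3 ^ P.card * ∏ q : P, (V q).card) * (3 * T) ^ d := by ring
    _ ≤ (2 ^ P.card * Q ^ d) * (3 * T) ^ d := Nat.mul_le_mul_right _ hprod
    _ = 2 ^ P.card * 3 ^ d * (T * Q) ^ d := by ring

/-- A system of digits `x` in base `W` with scaling factors `ρ x` such that for every `u ∈ U` the
values `x + ρ x ⊗ u` lie in a set of size at most `W ^ s`. -/
structure DigitSystem (n : ℕ) (U : Finset (Fin n.totient → ℤ)) (s : ℝ) where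
  W : ℕ
  two_le : 2 ≤ W
  ρ : (Fin n.totient → ℤ) → (Fin n.totient → ℤ)
  one_le_ρ : ∀ x i, 1 ≤ ρ x i
  ρ_le : ∀ x i, ρ x i ≤ (W : ℤ)
  Y : (Fin n.totient → ℤ) → Finset (Fin n.totient → ℤ)
  mem_Y : ∀ u ∈ U, ∀ x : Fin n.totient → ℤ, (∀ i, 0 ≤ x i ∧ x i < (W : ℤ)) →
    x + cycloMul n (ρ x) u ∈ Y u
  card_Y_le : ∀ u ∈ U, ((Y u).card : ℝ) ≤ (W : ℝ) ^ s

/-- The base W = 2CbQ is large enough that ρ ⊗ u is bounded by W in each coordinate, so the digit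
values stay in [-W, 2W) while obeying the quadratic restriction modulo every prime of P. -/
theorem exists_digits {n : ℕ} (hn : 0 < n) : ∃ C : ℕ, 1 ≤ C ∧
    ∀ (U : Finset (Fin n.totient → ℤ)) (b : ℕ), 1 ≤ b → (∀ u ∈ U, ∀ i, |u i| ≤ b) →
    ∀ P : Finset ℕ, (∀ q ∈ P, q.Prime ∧ q ≠ 2 ∧ ∀ u ∈ U, ¬ (q : ℤ) ∣ cycloNorm n u) →
    ∀ s : ℝ, (2 : ℝ) ^ P.card * 3 ^ n.totient *
      ((2 * C * b * ∏ q ∈ P, q : ℕ) : ℝ) ^ n.totient ≤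
        3 ^ P.card * ((2 * C * b * ∏ q ∈ P, q : ℕ) : ℝ) ^ s →
    Nonempty (DigitSystem n U s) := by
  classical
  obtain ⟨C, hC, hmul⟩ := exists_cycloMul_bound n
  refine ⟨C, hC, fun U b hb hU P hP s hs => ?_⟩
  set Q : ℕ := ∏ q ∈ P, q with hQ
  have hQ0 : 0 < Q := Finset.prod_pos fun q hq => (hP q hq).1.pos
  have hQZ : (0 : ℤ) < Q := by exact_mod_cast hQ0
  set W : ℕ := 2 * C * b * Q with hW
  have hCb : 1 ≤ C * b := Nat.mul_pos hC hb
  have hWZ : (W : ℤ) = 2 * (C * b) * Q := by rw [hW]; push_cast; ring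
  have hCbZ : (1 : ℤ) ≤ C * b := by exact_mod_cast hCb
  have hWQ : 2 * (Q : ℤ) ≤ W := by nlinarith
  -- Only the class of x ⊗ x modulo Q matters. Adding Q keeps every coordinate positive, so no
  -- cancellation between digits can make the full scaling factor vanish.
  let ρ : (Fin n.totient → ℤ) → (Fin n.totient → ℤ) := fun x i => cycloMul n x x i % Q + Q
  have hρ1 : ∀ x i, (Q : ℤ) ≤ ρ x i := fun x i => by
    have := Int.emod_nonneg (cycloMul n x x i) hQZ.ne'
    simp only [ρ]
    omega
  have hρ2 : ∀ x i, ρ x i ≤ 2 * Q := fun x i => by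
    have := Int.emod_lt_of_pos (cycloMul n x x i) hQZ
    simp only [ρ]
    omega
  let Y : (Fin n.totient → ℤ) → Finset (Fin n.totient → ℤ) := fun u =>
    (Fintype.piFinset fun _ => Finset.Ico (0 : ℤ) W).image fun x => x + cycloMul n (ρ x) u
  have hY : ∀ u ∈ U, ∀ y ∈ Y u, ∀ i, -(W : ℤ) ≤ y i ∧ y i < 2 * W := by
    intro u hu y hy i
    obtain ⟨x, hx, rfl⟩ := Finset.mem_image.1 hy
    have hxi := Finset.mem_Ico.1 (Fintype.mem_piFinset.1 hx i)
    have hb := abs_le.1 (hmul (ρ x) u (2 * Q) b (fun i => by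
      rw [abs_of_nonneg (hQZ.le.trans (hρ1 x i))]
      exact hρ2 x i) (hU u hu) i)
    simp only [Pi.add_apply]
    constructor <;> nlinarith
  refine ⟨⟨W, ?_, ρ, fun x i => ?_, fun x i => (hρ2 x i).trans hWQ, Y, fun u _ x hx => ?_,
    fun u hu => ?_⟩⟩
  · have : 1 ≤ C * b * Q := Nat.mul_pos hCb hQ0
    rw [hW]
    nlinarith
  · have := hρ1 x i
    omega
  · exact Finset.mem_image_of_mem _ (Fintype.mem_piFinset.2 fun i => Finset.mem_Ico.2 (hx i))
  · have : ∀ q : P, Fact (q : ℕ).Prime := fun q => ⟨(hP q q.2).1⟩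
    have hres : ∀ y ∈ Y u, ∀ q : P, (fun i => (y i : ZMod q)) ∈ quadValues n u q := by
      intro y hy q
      obtain ⟨x, -, rfl⟩ := Finset.mem_image.1 hy
      refine Finset.mem_image.2 ⟨fun i => (x i : ZMod q), Finset.mem_univ _, ?_⟩
      have hρq : (fun i => ((ρ x i : ℤ) : ZMod q)) = fun i => ((cycloMul n x x i : ℤ) : ZMod q) := by
        funext i
        have hqQ : ((q : ℕ) : ℤ) ∣ (Q : ℤ) := by
          exact_mod_cast Finset.dvd_prod_of_mem (fun q => q) q.2
        have h0 : ((Q : ℤ) : ZMod q) = 0 := (ZMod.intCast_zmod_eq_zero_iff_dvd _ _).2 hqQ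
        have h1 := congrArg (Int.cast : ℤ → ZMod q) (Int.mul_ediv_add_emod (cycloMul n x x i) Q)
        simp only [Int.cast_add, Int.cast_mul, h0, zero_mul, zero_add] at h1
        simp only [ρ, Int.cast_add, h0, add_zero, h1]
      rw [cycloMul_intCast, ← hρq, cycloMul_intCast]
      funext i
      simp
    have h := card_le_of_residues P (fun q hq => (hP q hq).1) (2 * C * b)
      (fun q => quadValues n u q) (fun q => card_quadValues_le hn u q (hP q q.2).2.1
        ((hP q q.2).2.2 u hu)) (Y u) hres (fun y hy i => by
        have := hY u hu y hy i
        rw [hW] at this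
        rw [← hQ]
        push_cast at this ⊢
        exact this)
    have h' : (3 : ℝ) ^ P.card * ((Y u).card : ℝ) ≤
        2 ^ P.card * 3 ^ n.totient * (W : ℝ) ^ n.totient := by
      exact_mod_cast h
    have h3 : (0 : ℝ) < 3 ^ P.card := by positivity
    exact le_of_mul_le_mul_left (h'.trans hs) h3

/-! ### Supply of primes and choice of parameters -/

/-- Chebyshev's lower bound gives order k⁵ / log k primes up to k⁵. The constant 1/20 makes 5 log k
≤ k/4, which leaves room below log 2 ≥ 1/2. -/
theorem eventually_pow_four_le_primeCounting :
    ∀ᶠ k : ℕ in atTop, k ^ 4 ≤ Nat.primeCounting (k ^ 5) := by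
  have hlog : ∀ᶠ k : ℕ in atTop, Real.log k ≤ (1 / 20) * k := by
    have h := (Real.isLittleO_log_id_atTop.bound (show (0 : ℝ) < 1 / 20 by norm_num))
    filter_upwards [tendsto_natCast_atTop_atTop.eventually h] with k hk
    have h1 := (le_abs_self _).trans hk
    simpa using h1
  filter_upwards [hlog, eventually_ge_atTop 4] with k hk hk4
  have hk4' : (4 : ℝ) ≤ k := by exact_mod_cast hk4
  have hlogpos : 0 < Real.log k := Real.log_pos (by linarith)
  have h := Chebyshev.pi_ge (k ^ 5)
  have h5 : (1 : ℝ) ≤ (k : ℝ) ^ 5 := one_le_pow₀ (by linarith)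
  have hl : Real.log ((k : ℝ) ^ 5 + 1) ≤ k := by
    calc Real.log ((k : ℝ) ^ 5 + 1) ≤ Real.log ((k : ℝ) ^ 6) := by
          apply Real.log_le_log (by positivity)
          nlinarith [pow_succ (k : ℝ) 5]
      _ = 6 * Real.log k := by rw [Real.log_pow]; norm_num
      _ ≤ k := by linarith
  push_cast at h
  rw [Real.log_pow, div_le_iff₀ (by positivity)] at h
  have hl2 : (1 / 2 : ℝ) ≤ Real.log 2 := by
    have := Real.one_sub_inv_le_log_of_pos (show (0 : ℝ) < 2 by norm_num)
    linarith
  by_contra hlt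
  have hlt' : (Nat.primeCounting (k ^ 5) : ℝ) ≤ (k : ℝ) ^ 4 := by
    exact_mod_cast (not_le.1 hlt).le
  have h1 : (Nat.primeCounting (k ^ 5) : ℝ) * ((5 : ℕ) * Real.log k) ≤
      (k : ℝ) ^ 4 * ((1 / 4) * k) := by
    refine mul_le_mul hlt' ?_ (by positivity) (by positivity)
    push_cast
    linarith
  have h2 : (k : ℝ) ^ 5 * (1 / 2) ≤ (k : ℝ) ^ 5 * Real.log 2 := by gcongr
  have h3 : 4 ^ 4 * (k : ℝ) ≤ (k : ℝ) ^ 5 := by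
    rw [pow_succ (k : ℝ) 4]
    gcongr
  have h4 : (k : ℝ) ^ 4 * ((1 / 4) * k) = (k : ℝ) ^ 5 / 4 := by ring
  have h6 := h.trans h1
  linarith

theorem eventually_exists_primes : ∀ᶠ k : ℕ in atTop, ∀ S : Finset ℕ, S.card ≤ k ^ 3 →
    ∃ P : Finset ℕ, P.card = k ∧ ∀ q ∈ P, q.Prime ∧ q ≠ 2 ∧ q ≤ k ^ 5 ∧ q ∉ S := by
  filter_upwards [eventually_pow_four_le_primeCounting, eventually_ge_atTop 3] with k hk hk3 S hS
  have hcard : (Nat.primesLE (k ^ 5)).card = Nat.primeCounting (k ^ 5) :=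
    Nat.primesLE_card_eq_primeCounting _
  have h1 : k ≤ (Nat.primesLE (k ^ 5) \ insert 2 S).card := by
    have h2 := Finset.le_card_sdiff (insert 2 S) (Nat.primesLE (k ^ 5))
    have h3 := Finset.card_insert_le 2 S
    have h4 : k ^ 3 + 1 + k ≤ k ^ 4 := by
      have : 3 * k ^ 3 ≤ k ^ 4 := by rw [pow_succ k 3, mul_comm]; gcongr
      have h5 : k ≤ k ^ 3 := Nat.le_self_pow (by norm_num) k
      omega
    omega
  obtain ⟨P, hP, hPk⟩ := Finset.exists_subset_card_eq h1
  refine ⟨P, hPk, fun q hq => ?_⟩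
  have h := hP hq
  simp only [Finset.mem_sdiff, Nat.mem_primesLE, Finset.mem_insert, not_or] at h
  exact ⟨h.1.2, h.2.1, h.1.1, h.2.2⟩

theorem two_pow_card_primeFactors_le {D : ℕ} (hD : D ≠ 0) : 2 ^ D.primeFactors.card ≤ D :=
  (Finset.pow_card_le_prod _ _ _ fun _ hp => (Nat.prime_of_mem_primeFactors hp).two_le).trans
    (Nat.le_of_dvd (Nat.pos_of_ne_zero hD) (Nat.prod_primeFactors_dvd D))

/-- After taking logarithms, log W ≤ 6k log k makes the loss from the exponent at most k/5, whereas
k log(3/2) ≥ k/3. The difference 2k/15 pays for 3^d ≤ e^(2d) because 15d ≤ k. -/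
theorem digit_card_inequality (d C k Q : ℕ) (hC : 1 ≤ C) (hk : 4 ≤ k) (hkC : 4 * C ≤ k)
    (hkd : 15 * d ≤ k) (hQ0 : 0 < Q) (hQ : Q ≤ (k ^ 5) ^ k) :
    (2 : ℝ) ^ k * 3 ^ d * ((2 * C * 2 ^ k * Q : ℕ) : ℝ) ^ d ≤
      3 ^ k * ((2 * C * 2 ^ k * Q : ℕ) : ℝ) ^ ((d : ℝ) - (1 / 30) / Real.log k) := by
  set W : ℕ := 2 * C * 2 ^ k * Q with hW
  have hW0 : 0 < W := by positivity
  have hWR : (0 : ℝ) < W := by exact_mod_cast hW0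
  have hk' : (4 : ℝ) ≤ k := by exact_mod_cast hk
  have hC' : (1 : ℝ) ≤ C := by exact_mod_cast hC
  have hQR : (0 : ℝ) < Q := by exact_mod_cast hQ0
  have hkC' : 4 * (C : ℝ) ≤ k := by exact_mod_cast hkC
  have hkd' : 15 * (d : ℝ) ≤ k := by exact_mod_cast hkd
  have h2log : 2 * Real.log 2 ≤ Real.log k := by
    have : Real.log ((2 : ℝ) ^ 2) ≤ Real.log k := Real.log_le_log (by norm_num) (by linarith)
    rw [Real.log_pow] at this
    exact_mod_cast this
  have hl2 : (1 / 2 : ℝ) ≤ Real.log 2 := by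
    have := Real.one_sub_inv_le_log_of_pos (show (0 : ℝ) < 2 by norm_num)
    linarith
  have hlk : 0 < Real.log k := by linarith
  have hlW : Real.log W ≤ 6 * k * Real.log k := by
    have h1 : Real.log W = Real.log (2 * C) + k * Real.log 2 + Real.log Q := by
      rw [hW]
      push_cast
      rw [Real.log_mul (by positivity) (by positivity), Real.log_mul (by positivity) (by positivity),
        Real.log_pow]
    have h2 : Real.log Q ≤ 5 * k * Real.log k := by
      have h3 : (Q : ℝ) ≤ ((k : ℝ) ^ 5) ^ k := by exact_mod_cast hQ
      have := Real.log_le_log hQR h3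
      rw [Real.log_pow, Real.log_pow] at this
      push_cast at this
      linarith
    have h4 : Real.log (2 * C) ≤ k / 2 := by
      have := Real.log_le_sub_one_of_pos (show (0 : ℝ) < 2 * C by positivity)
      linarith
    have h5 : (k : ℝ) / 2 ≤ k * Real.log k / 2 := by nlinarith
    nlinarith
  have hmain : (2 : ℝ) ^ k * 3 ^ d ≤ 3 ^ k * (W : ℝ) ^ (-((1 / 30) / Real.log k)) := by
    rw [← Real.log_le_log_iff (by positivity) (by positivity),
      Real.log_mul (by positivity) (by positivity), Real.log_mul (by positivity) (by positivity),
      Real.log_pow, Real.log_pow, Real.log_pow, Real.log_rpow hWR]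
    have h6 : (1 / 30) / Real.log k * Real.log W ≤ k / 5 := by
      rw [div_mul_eq_mul_div, div_le_iff₀ hlk]
      linarith
    have h7 : Real.log 2 + 1 / 3 ≤ Real.log 3 := by
      have := Real.one_sub_inv_le_log_of_pos (show (0 : ℝ) < 3 / 2 by norm_num)
      rw [Real.log_div (by norm_num) (by norm_num)] at this
      norm_num at this ⊢
      linarith
    have h8 : Real.log 3 ≤ 2 := by
      have := Real.log_le_sub_one_of_pos (show (0 : ℝ) < 3 by norm_num)
      linarith
    have h9 : (d : ℝ) * Real.log 3 ≤ d * 2 := by gcongr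
    nlinarith
  calc (2 : ℝ) ^ k * 3 ^ d * (W : ℝ) ^ d
      ≤ 3 ^ k * (W : ℝ) ^ (-((1 / 30) / Real.log k)) * (W : ℝ) ^ d := by gcongr
    _ = 3 ^ k * (W : ℝ) ^ ((d : ℝ) - (1 / 30) / Real.log k) := by
      rw [mul_assoc, ← Real.rpow_natCast (W : ℝ) d, ← Real.rpow_add hWR]
      ring_nf

theorem eventually_digitSystem {n : ℕ} (hn : 0 < n) (U : ℕ → Finset (Fin n.totient → ℤ))
    (hcard : ∀ k, (U k).card = k) (hU : ∀ k, ∀ u ∈ U k, ∀ i, u i ≠ 0)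
    (hg : ∃ g : ℕ → ℝ, g =o[atTop] (fun k : ℕ => (k : ℝ)) ∧
      ∀ k, ∀ u ∈ U k, ∀ i, |(u i : ℝ)| ≤ (2 : ℝ) ^ g k) :
    ∀ᶠ k : ℕ in atTop,
      Nonempty (DigitSystem n (U k) ((n.totient : ℝ) - (1 / 30) / Real.log k)) := by
  obtain ⟨g, hgo, hgU⟩ := hg
  obtain ⟨C, hC, hdig⟩ := exists_digits hn
  obtain ⟨D, hD, hnorm⟩ := exists_cycloNorm_bound n
  filter_upwards [eventually_exists_primes, hgo.bound one_pos, eventually_ge_atTop 4,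
    eventually_ge_atTop (4 * C), eventually_ge_atTop (15 * n.totient),
    eventually_ge_atTop (D + n.totient)] with k hprimes hgk hk4 hkC hkd hkD
  have hgk' : g k ≤ k := by
    have := (le_abs_self _).trans hgk
    simpa using this
  have hbound : ∀ u ∈ U k, ∀ i, |u i| ≤ ((2 ^ k : ℕ) : ℤ) := by
    intro u hu i
    have h1 : |(u i : ℝ)| ≤ (2 : ℝ) ^ k := by
      refine (hgU k u hu i).trans ?_
      rw [← Real.rpow_natCast]
      exact Real.rpow_le_rpow_of_exponent_le one_le_two hgk'
    exact_mod_cast h1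
  have hne : ∏ u ∈ U k, (cycloNorm n u).natAbs ≠ 0 := by
    refine Finset.prod_ne_zero_iff.2 fun u hu => Int.natAbs_ne_zero.2 (cycloNorm_ne_zero hn ?_)
    intro h
    exact hU k u hu ⟨0, Nat.totient_pos.2 hn⟩ (by rw [h]; rfl)
  -- An integer has at most log₂ of its size many prime factors, and the product of the k norms is
  -- at most 2^((D + kd)k) ≤ 2^(k³).
  have hS : (∏ u ∈ U k, (cycloNorm n u).natAbs).primeFactors.card ≤ k ^ 3 := by
    have h1 : ∏ u ∈ U k, (cycloNorm n u).natAbs ≤ (2 ^ (D + k * n.totient)) ^ k := by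
      rw [← hcard k, ← Finset.prod_const, hcard k]
      refine Finset.prod_le_prod' fun u hu => (hnorm u (2 ^ k) (hbound u hu)).trans ?_
      rw [pow_add, pow_mul]
      exact Nat.mul_le_mul_right _ Nat.lt_two_pow_self.le
    have h2 := (two_pow_card_primeFactors_le hne).trans h1
    rw [← pow_mul] at h2
    refine ((Nat.pow_le_pow_iff_right (by norm_num)).1 h2).trans ?_
    have h3 : D + k * n.totient ≤ k ^ 2 := by nlinarith [Nat.zero_le n.totient]
    calc (D + k * n.totient) * k ≤ k ^ 2 * k := Nat.mul_le_mul_right _ h3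
      _ = k ^ 3 := by ring
  obtain ⟨P, hPk, hP⟩ := hprimes _ hS
  have hQ : ∏ q ∈ P, q ≤ (k ^ 5) ^ k := by
    rw [← hPk, ← Finset.prod_const, hPk]
    exact Finset.prod_le_prod' fun q hq => (hP q hq).2.2.1
  refine hdig (U k) (2 ^ k) Nat.one_le_two_pow hbound P (fun q hq => ⟨(hP q hq).1, (hP q hq).2.1,
    fun u hu hdvd => (hP q hq).2.2.2 ?_⟩) _ ?_
  · exact Nat.mem_primeFactors.2 ⟨(hP q hq).1,
      (Int.natCast_dvd.1 hdvd).trans (Finset.dvd_prod_of_mem _ hu), hne⟩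
  · rw [hPk]
    exact digit_card_inequality _ C k _ hC hk4 hkC hkd
      (Finset.prod_pos fun q hq => (hP q hq).1.pos) hQ

/-! ### Base W expansions and the discrete statement -/

namespace DigitSystem

variable {n : ℕ} {U : Finset (Fin n.totient → ℤ)} {s : ℝ}

/-- The scaling factor attached to an integer vector whose coordinates have `m` digits. -/
def factor (D : DigitSystem n U s) : ℕ → (Fin n.totient → ℤ) → (Fin n.totient → ℤ)
  | 0, _ => 0
  | m + 1, x => (D.W : ℤ) • D.factor m (fun i => x i / D.W) + D.ρ (fun i => x i % D.W)

open Classical in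
/-- A set containing all the points `x + factor m x ⊗ u`. -/
noncomputable def values (D : DigitSystem n U s) (u : Fin n.totient → ℤ) :
    ℕ → Finset (Fin n.totient → ℤ)
  | 0 => {0}
  | m + 1 => Finset.image₂ (fun z y => (D.W : ℤ) • z + y) (D.values u m) (D.Y u)

theorem W_pos (D : DigitSystem n U s) : 0 < D.W := by have := D.two_le; omega

/-- The leading digit contributes at least W^m and the others are positive. This gives r ≠ 0 for
integers and, after rescaling, a lower bound that survives the limit to real factors. -/
theorem pow_le_factor (D : DigitSystem n U s) (m : ℕ) (x : Fin n.totient → ℤ)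
    (i : Fin n.totient) : (D.W : ℤ) ^ m ≤ D.factor (m + 1) x i := by
  induction m generalizing x with
  | zero =>
    have h1 := D.one_le_ρ (fun i => x i % D.W) i
    simpa [factor] using h1
  | succ m ih =>
    have h1 := D.one_le_ρ (fun i => x i % D.W) i
    have h2 := mul_le_mul_of_nonneg_left (ih fun i => x i / D.W) (Int.natCast_nonneg D.W)
    rw [factor, pow_succ']
    simp only [Pi.add_apply, Pi.smul_apply, smul_eq_mul]
    omega

/-- The vector x and its factor obey the same base W recursion and ⊗ is linear in the factor, so the
sum splits digit by digit; carries are harmless because only the number of digit choices is counted.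
-/
theorem add_factor_mem_values (D : DigitSystem n U s) {u : Fin n.totient → ℤ} (hu : u ∈ U) (m : ℕ)
    (x : Fin n.totient → ℤ) (hx : ∀ i, 0 ≤ x i ∧ x i < (D.W : ℤ) ^ m) :
    x + cycloMul n (D.factor m x) u ∈ D.values u m := by
  classical
  have hW : (0 : ℤ) < D.W := by exact_mod_cast D.W_pos
  induction m generalizing x with
  | zero =>
    have hx0 : x = 0 := by
      funext i
      have := hx i
      simp only [pow_zero] at this
      simp only [Pi.zero_apply]
      omega
    rw [hx0, factor, ← cycloLin_apply, map_zero]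
    simp [values]
  | succ m ih =>
    refine Finset.mem_image₂.2 ⟨_, ih (fun i => x i / D.W) fun i => ⟨?_, ?_⟩, _,
      D.mem_Y u hu (fun i => x i % D.W) fun i => ⟨?_, ?_⟩, ?_⟩
    · exact Int.ediv_nonneg (hx i).1 hW.le
    · rw [Int.ediv_lt_iff_lt_mul hW, ← pow_succ]
      exact (hx i).2
    · exact Int.emod_nonneg _ hW.ne'
    · exact Int.emod_lt_of_pos _ hW
    · simp only [factor, ← cycloLin_apply, map_add, map_smul]
      funext i
      have := Int.mul_ediv_add_emod (x i) D.W
      simp only [Pi.add_apply, Pi.smul_apply, smul_eq_mul]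
      linarith

theorem card_values_le (D : DigitSystem n U s) {u : Fin n.totient → ℤ} (hu : u ∈ U) (m : ℕ) :
    ((D.values u m).card : ℝ) ≤ ((D.W : ℝ) ^ m) ^ s := by
  classical
  induction m with
  | zero => simp [values]
  | succ m ih =>
    rw [pow_succ, Real.mul_rpow (by positivity) (by positivity)]
    calc ((D.values u (m + 1)).card : ℝ)
        ≤ ((D.values u m).card : ℝ) * ((D.Y u).card : ℝ) := by
          exact_mod_cast Finset.card_image₂_le _ _ _
      _ ≤ _ := mul_le_mul ih (D.card_Y_le u hu) (by positivity) (by positivity)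

end DigitSystem

/-- Rounding N up to a power of W and taking the union over U cost the constant |U| W^s, which N^(t
- s) eventually exceeds. -/
theorem DigitSystem.eventually_exists_finset {n : ℕ} (hn : 0 < n)
    {U : Finset (Fin n.totient → ℤ)} {s t : ℝ} (D : DigitSystem n U s) (hs : 0 ≤ s) (hst : s < t) :
    ∀ᶠ N : ℕ in atTop, ∃ B : Finset (Fin n.totient → ℤ),
      (∀ x : Fin n.totient → ℤ, (∀ i, x i ∈ Finset.Icc (1 : ℤ) N) →
        ContainsPattern n U (B : Set (Fin n.totient → ℤ)) x) ∧ (B.card : ℝ) < (N : ℝ) ^ t := by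
  classical
  have hlim : ∀ᶠ N : ℕ in atTop, U.card * (D.W : ℝ) ^ s < (N : ℝ) ^ (t - s) :=
    ((tendsto_rpow_atTop (sub_pos.2 hst)).comp tendsto_natCast_atTop_atTop).eventually_gt_atTop _
  filter_upwards [hlim, eventually_ge_atTop 1] with N hN hN1
  have hN0 : (0 : ℝ) < N := by exact_mod_cast hN1
  set m := Nat.log D.W N
  set Z := fun u => D.values u (m + 1)
  refine ⟨U.biUnion Z, fun x hx => ⟨D.factor (m + 1) x, fun h => ?_, fun u hu => ?_⟩, ?_⟩
  · have h1 := D.pow_le_factor m x ⟨0, Nat.totient_pos.2 hn⟩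
    have h2 : (0 : ℤ) < (D.W : ℤ) ^ m := pow_pos (by exact_mod_cast D.W_pos) _
    rw [h] at h1
    exact absurd h1 (not_le.2 h2)
  · refine Finset.mem_coe.2 (Finset.mem_biUnion.2 ⟨u, hu, ?_⟩)
    refine D.add_factor_mem_values hu _ x fun i => ?_
    have h1 := Finset.mem_Icc.1 (hx i)
    have h2 : (N : ℤ) < (D.W : ℤ) ^ (m + 1) := by
      exact_mod_cast Nat.lt_pow_succ_log_self (by have := D.two_le; omega) N
    omega
  · calc ((U.biUnion Z).card : ℝ) ≤ ∑ u ∈ U, ((Z u).card : ℝ) := by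
          exact_mod_cast Finset.card_biUnion_le
      _ ≤ ∑ _u ∈ U, ((D.W : ℝ) ^ (m + 1)) ^ s :=
          Finset.sum_le_sum fun u hu => D.card_values_le hu (m + 1)
      _ = (U.card * (D.W : ℝ) ^ s) * ((D.W : ℝ) ^ m) ^ s := by
          rw [Finset.sum_const, nsmul_eq_mul, pow_succ, Real.mul_rpow (by positivity) (by positivity)]
          ring
      _ ≤ (U.card * (D.W : ℝ) ^ s) * (N : ℝ) ^ s := by
          gcongr
          exact_mod_cast Nat.pow_log_le_self D.W (by omega)
      _ < (N : ℝ) ^ (t - s) * (N : ℝ) ^ s := by gcongr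
      _ = (N : ℝ) ^ t := by rw [← Real.rpow_add hN0, sub_add_cancel]

theorem eventually_exponent_nonneg {n : ℕ} (hn : 0 < n) :
    ∀ᶠ k : ℕ in atTop, 0 < Real.log k ∧ 0 ≤ (n.totient : ℝ) - (1 / 30) / Real.log k := by
  filter_upwards [eventually_ge_atTop 3] with k hk
  have hk' : (3 : ℝ) ≤ k := by exact_mod_cast hk
  have h1 : 1 - ((3 : ℝ))⁻¹ ≤ Real.log k :=
    (Real.one_sub_inv_le_log_of_pos (by norm_num)).trans (Real.log_le_log (by norm_num) hk')
  have h2 : (1 : ℝ) ≤ n.totient := by exact_mod_cast Nat.totient_pos.2 hn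
  have h3 : (0 : ℝ) < Real.log k := by norm_num at h1; linarith
  refine ⟨h3, ?_⟩
  have : (1 / 30) / Real.log k ≤ 1 := by
    rw [div_le_one h3]
    norm_num at h1 ⊢
    linarith
  linarith

theorem eventually_exists_small_finset {n : ℕ} (hn : 0 < n) (U : ℕ → Finset (Fin n.totient → ℤ))
    (hcard : ∀ k, (U k).card = k) (hU : ∀ k, ∀ u ∈ U k, ∀ i, u i ≠ 0)
    (hg : ∃ g : ℕ → ℝ, g =o[atTop] (fun k : ℕ => (k : ℝ)) ∧
      ∀ k, ∀ u ∈ U k, ∀ i, |(u i : ℝ)| ≤ (2 : ℝ) ^ g k) :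
    ∀ᶠ k : ℕ in atTop, ∀ᶠ N : ℕ in atTop,
      ∃ B : Finset (Fin n.totient → ℤ),
        (∀ x : Fin n.totient → ℤ, (∀ i, x i ∈ Finset.Icc (1 : ℤ) N) →
          ContainsPattern n (U k) (B : Set (Fin n.totient → ℤ)) x) ∧
        (B.card : ℝ) < (N : ℝ) ^ ((n.totient : ℝ) - (1 / 60) / Real.log k) := by
  filter_upwards [eventually_digitSystem hn U hcard hU hg, eventually_exponent_nonneg hn]
    with k ⟨D⟩ ⟨hlog, hs⟩
  refine D.eventually_exists_finset hn hs (sub_lt_sub_left ?_ _)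
  gcongr
  norm_num

/-! ### Arithmetic progressions -/

theorem gPrime_le {k N : ℕ} (B : Finset ℤ) (hB : ∀ x ∈ Finset.Icc (1 : ℤ) N,
    ContainsAP k (B : Set ℤ) x) : gPrime k N ≤ B.card :=
  Nat.sInf_le ⟨B, Finset.Icc 1 N, rfl, by simp, hB⟩

theorem ContainsAP.mono {k l : ℕ} (hkl : k ≤ l) {B : Set ℤ} {x : ℤ} (h : ContainsAP l B x) :
    ContainsAP k B x := by
  obtain ⟨r, hr, h⟩ := h
  refine ⟨r, hr, fun i hi => h i ?_⟩
  simp only [Finset.mem_Icc] at *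
  omega

theorem gPrime_mono {k l : ℕ} (hkl : k ≤ l) (N : ℕ) : gPrime k N ≤ gPrime l N := by
  obtain ⟨B, S, hB, hS, h⟩ := gPrime_spec l N
  rw [← hB]
  exact Nat.sInf_le ⟨B, S, rfl, hS, fun x hx => (h x hx).mono hkl⟩

theorem fin_totient_two_eq (i j : Fin (Nat.totient 2)) : i = j := by
  have hi := i.2.trans_eq Nat.totient_two
  have hj := j.2.trans_eq Nat.totient_two
  exact Fin.ext (by omega)

theorem cycloMul_two (r u : Fin (Nat.totient 2) → ℤ) (l : Fin (Nat.totient 2)) :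
    cycloMul 2 r u l = r l * u l := by
  have hval : ∀ i : Fin (Nat.totient 2), (i : ℕ) = 0 := fun i => by
    have := i.2.trans_eq Nat.totient_two
    omega
  have hroot : aeval (-1 : ℤ) (cyclotomic 2 ℤ) = 0 := by simp [cyclotomic_two]
  have huniv : (Finset.univ : Finset (Fin (Nat.totient 2))) = {l} := by
    ext i
    simp [fin_totient_two_eq i l]
  have h := zetaCoord_cycloMul 2 (-1 : ℤ) hroot r u
  simpa [zetaCoord, huniv, hval] using h

theorem eventually_gPrime_le : ∀ᶠ k : ℕ in atTop, ∀ᶠ N : ℕ in atTop,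
    (gPrime k N : ℝ) ≤ (N : ℝ) ^ (1 - (1 / 60) / Real.log k) := by
  classical
  have hinj : Function.Injective (fun (i : ℤ) (_ : Fin (Nat.totient 2)) => i) := fun a b hab =>
    congrFun hab ⟨0, Nat.totient_pos.2 two_pos⟩
  have h := eventually_exists_small_finset two_pos
    (fun k => (Finset.Icc (1 : ℤ) k).image fun i _ => i)
    (fun k => by rw [Finset.card_image_of_injective _ hinj]; simp)
    (fun k u hu i => by
      obtain ⟨a, ha, rfl⟩ := Finset.mem_image.1 hu
      have := Finset.mem_Icc.1 ha
      simp only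
      omega)
    -- The largest element of {1, …, k} is k = 2^(log₂ k), and log₂ k = o(k).
    ⟨fun k => Real.log k / Real.log 2, by
      have h1 := (Real.isLittleO_log_id_atTop.comp_tendsto tendsto_natCast_atTop_atTop).const_mul_left
        (Real.log 2)⁻¹
      refine h1.congr_left fun k => ?_
      simp [div_eq_inv_mul], fun k u hu i => by
      obtain ⟨a, ha, rfl⟩ := Finset.mem_image.1 hu
      have h2 := Finset.mem_Icc.1 ha
      have hk : (0 : ℝ) < k := by exact_mod_cast (by omega : (0 : ℤ) < k)
      rw [Real.rpow_def_of_pos two_pos, mul_div_cancel₀ _ (Real.log_pos one_lt_two).ne',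
        Real.exp_log hk, abs_of_nonneg (by exact_mod_cast (by omega : (0 : ℤ) ≤ a))]
      exact_mod_cast h2.2⟩
  filter_upwards [h] with k hk
  filter_upwards [hk] with N ⟨B, hB, hcard⟩
  have h0 : Fin (Nat.totient 2) := ⟨0, Nat.totient_pos.2 two_pos⟩
  have hle : gPrime k N ≤ B.card := by
    refine (gPrime_le (B.image fun y => y h0) fun x hx => ?_).trans Finset.card_image_le
    obtain ⟨r, hr, hr'⟩ := hB (fun _ => x) fun _ => hx
    refine ⟨r h0, fun h => hr ?_, fun i hi => ?_⟩
    · funext i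
      rw [fin_totient_two_eq i h0, h]
      rfl
    · have hi' := Finset.mem_Icc.1 hi
      have h3 := hr' (fun _ => (i : ℤ)) (Finset.mem_image_of_mem _
        (Finset.mem_Icc.2 ⟨by exact_mod_cast hi'.1, by exact_mod_cast hi'.2⟩))
      refine Finset.mem_coe.2 (Finset.mem_image.2 ⟨_, h3, ?_⟩)
      simp only [Pi.add_apply, cycloMul_two, Int.cast_id]
      ring
  have hcard' := hcard.le
  simp only [Nat.totient_two, Nat.cast_one] at hcard'
  exact (Nat.cast_le.2 hle).trans hcard'

/-- For k below the threshold L the bound for L is used, by monotonicity in k. Shrinking the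
constant by log 2 / log L makes this sufficient for all k ≥ 2. -/
theorem exists_gPrime_le : ∃ c : ℝ, 0 < c ∧ ∀ k : ℕ, 2 ≤ k → ∀ᶠ N : ℕ in atTop,
    (gPrime k N : ℝ) ≤ (N : ℝ) ^ (1 - c / Real.log k) := by
  obtain ⟨K, hK⟩ := eventually_atTop.1 eventually_gPrime_le
  set L : ℕ := max K 2
  have hL2 : (2 : ℝ) ≤ L := by exact_mod_cast le_max_right K 2
  have hl2 : 0 < Real.log 2 := Real.log_pos one_lt_two
  have hlL : Real.log 2 ≤ Real.log L := Real.log_le_log two_pos hL2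
  have hlL0 : 0 < Real.log L := hl2.trans_le hlL
  refine ⟨(1 / 60) * (Real.log 2 / Real.log L), by positivity, fun k hk => ?_⟩
  have hk2 : (2 : ℝ) ≤ k := by exact_mod_cast hk
  have hlk : Real.log 2 ≤ Real.log k := Real.log_le_log two_pos hk2
  have hlk0 : 0 < Real.log k := hl2.trans_le hlk
  have hmax := hK (max k L) ((le_max_left K 2).trans (le_max_right k L))
  filter_upwards [hmax, eventually_ge_atTop 1] with N hN hN1
  have hN1' : (1 : ℝ) ≤ N := by exact_mod_cast hN1
  refine (Nat.cast_le.2 (gPrime_mono (le_max_left k L) N)).trans (hN.trans ?_)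
  refine Real.rpow_le_rpow_of_exponent_le hN1' (sub_le_sub_left ?_ _)
  rcases le_total k L with h | h
  · rw [max_eq_right h, mul_div_assoc]
    rw [div_eq_mul_inv (1 / 60 : ℝ) (Real.log L)]
    refine mul_le_mul_of_nonneg_left ?_ (by norm_num)
    rw [div_div, inv_eq_one_div, div_le_div_iff₀ (by positivity) hlL0]
    nlinarith
  · rw [max_eq_left h]
    gcongr
    have : Real.log 2 / Real.log L ≤ 1 := (div_le_one hlL0).2 hlL
    linarith

/-! ### Box counting -/

/-- For every `ε ∈ (0, 1)`, the set `E` is covered by `O(ε ^ (-s))` cubes of side `ε`. -/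
def HasBoxUpper {d : ℕ} (E : Set (Fin d → ℝ)) (s : ℝ) : Prop :=
  ∃ C : ℝ, 0 < C ∧ ∀ ε : ℝ, 0 < ε → ε < 1 → ∃ P : Finset (Fin d → ℝ),
    (P.card : ℝ) ≤ C * (1 / ε) ^ s ∧ E ⊆ ⋃ p ∈ P, Set.Icc p (fun i => p i + ε)

/-- For every small `ε`, the set `E` contains `≫ ε ^ (-s)` points with distances larger than `ε`. -/
def HasBoxLower {d : ℕ} (E : Set (Fin d → ℝ)) (s : ℝ) : Prop :=
  ∃ c : ℝ, 0 < c ∧ ∀ ε : ℝ, 0 < ε → ε < 1 / 2 → ∃ A : Finset (Fin d → ℝ),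
    c * (1 / ε) ^ s ≤ A.card ∧ (A : Set (Fin d → ℝ)) ⊆ E ∧
      ∀ a ∈ A, ∀ b ∈ A, a ≠ b → ∃ i, ε < |a i - b i|

theorem HasBoxUpper.union {d : ℕ} {E F : Set (Fin d → ℝ)} {s : ℝ} (hE : HasBoxUpper E s)
    (hF : HasBoxUpper F s) : HasBoxUpper (E ∪ F) s := by
  classical
  obtain ⟨C, hC, hE⟩ := hE
  obtain ⟨D, hD, hF⟩ := hF
  refine ⟨C + D, by positivity, fun ε h0 h1 => ?_⟩
  obtain ⟨P, hP, hEP⟩ := hE ε h0 h1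
  obtain ⟨P', hP', hFP⟩ := hF ε h0 h1
  refine ⟨P ∪ P', ?_, Set.union_subset (hEP.trans ?_) (hFP.trans ?_)⟩
  · have : ((P ∪ P').card : ℝ) ≤ P.card + P'.card := by exact_mod_cast Finset.card_union_le _ _
    linarith
  · exact Set.biUnion_subset_biUnion_left fun p hp => Finset.mem_union_left _ hp
  · exact Set.biUnion_subset_biUnion_left fun p hp => Finset.mem_union_right _ hp

theorem HasBoxUpper.biUnion {ι : Type*} {d : ℕ} (U : Finset ι) (E : ι → Set (Fin d → ℝ)) {s : ℝ}
    (hE : ∀ u ∈ U, HasBoxUpper (E u) s) : HasBoxUpper (⋃ u ∈ U, E u) s := by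
  classical
  induction U using Finset.induction_on with
  | empty => exact ⟨1, one_pos, fun ε h0 _ => ⟨∅, by simp; positivity, by simp⟩⟩
  | insert a t _ ih =>
    rw [Finset.set_biUnion_insert]
    exact (hE a (Finset.mem_insert_self _ _)).union
      (ih fun u hu => hE u (Finset.mem_insert_of_mem hu))

/-- A finite union of closed cubes is closed, so the same cubes cover the closure. -/
theorem HasBoxUpper.closure {d : ℕ} {E : Set (Fin d → ℝ)} {s : ℝ} (hE : HasBoxUpper E s) :
    HasBoxUpper (closure E) s := by
  obtain ⟨C, hC, hE⟩ := hE
  refine ⟨C, hC, fun ε h0 h1 => ?_⟩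
  obtain ⟨P, hP, hEP⟩ := hE ε h0 h1
  exact ⟨P, hP, closure_minimal hEP (P.finite_toSet.isClosed_biUnion fun p _ => isClosed_Icc)⟩

theorem HasBoxUpper.isCompact_closure {d : ℕ} {E : Set (Fin d → ℝ)} {s : ℝ}
    (hE : HasBoxUpper E s) : IsCompact (_root_.closure E) := by
  obtain ⟨C, -, hE⟩ := hE.closure
  obtain ⟨P, -, hEP⟩ := hE (1 / 2) (by norm_num) (by norm_num)
  exact (P.finite_toSet.isCompact_biUnion fun p _ => isCompact_Icc).of_isClosed_subset
    isClosed_closure hEP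

theorem HasBoxLower.mono {d : ℕ} {E F : Set (Fin d → ℝ)} {s : ℝ} (hE : HasBoxLower E s)
    (h : E ⊆ F) : HasBoxLower F s := by
  obtain ⟨c, hc, hE⟩ := hE
  refine ⟨c, hc, fun ε h0 h1 => ?_⟩
  obtain ⟨A, hA, hAE, hsep⟩ := hE ε h0 h1
  exact ⟨A, hA, hAE.trans h, hsep⟩

theorem boxCount_le_card {d : ℕ} {E : Set (Fin d → ℝ)} {ε : ℝ} (P : Finset (Fin d → ℝ))
    (hP : P.Nonempty) (hE : E ⊆ ⋃ p ∈ P, Set.Icc p (fun i => p i + ε)) :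
    boxCount E ε ≤ P.card ∧ 0 < boxCount E ε ∧ ∃ a : Fin (boxCount E ε) → (Fin d → ℝ),
      E ⊆ ⋃ j, Set.Icc (a j) (fun i => a j i + ε) := by
  have hmem : P.card ∈ {m : ℕ | 0 < m ∧ ∃ a : Fin m → (Fin d → ℝ),
      E ⊆ ⋃ j, Set.Icc (a j) (fun i => a j i + ε)} := by
    refine ⟨hP.card_pos, fun j => (P.equivFin.symm j : Fin d → ℝ), fun x hx => ?_⟩
    obtain ⟨p, hp, hxp⟩ := Set.mem_iUnion₂.1 (hE hx)
    refine Set.mem_iUnion.2 ⟨P.equivFin ⟨p, hp⟩, ?_⟩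
    simpa using hxp
  exact ⟨Nat.sInf_le hmem, Nat.sInf_mem ⟨_, hmem⟩⟩

theorem card_le_of_separated {d m : ℕ} {E : Set (Fin d → ℝ)} {ε : ℝ} (a : Fin m → (Fin d → ℝ))
    (hE : E ⊆ ⋃ j, Set.Icc (a j) (fun i => a j i + ε)) (A : Finset (Fin d → ℝ))
    (hA : (A : Set (Fin d → ℝ)) ⊆ E)
    (hsep : ∀ x ∈ A, ∀ y ∈ A, x ≠ y → ∃ i, ε < |x i - y i|) : A.card ≤ m := by
  have hex : ∀ x : A, ∃ j, (x : Fin d → ℝ) ∈ Set.Icc (a j) (fun i => a j i + ε) :=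
    fun x => Set.mem_iUnion.1 (hE (hA x.2))
  choose f hf using hex
  have hinj : Function.Injective f := by
    intro x y hxy
    by_contra hne
    obtain ⟨i, hi⟩ := hsep x x.2 y y.2 fun h => hne (Subtype.ext h)
    have hx := hf x
    have hy := hf y
    rw [← hxy] at hy
    have h1 := hx.1 i
    have h2 := hx.2 i
    have h3 := hy.1 i
    have h4 := hy.2 i
    simp only at h2 h4
    rcases lt_abs.1 hi with h | h <;> linarith
  simpa using Fintype.card_le_of_injective f hinj

/-- The multiplicative constants change the quotient of logarithms only by O(1 / log(1/ε)), so it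
converges and its upper limit is s. -/
theorem minkowskiDim_eq_of_bounds {d : ℕ} {E : Set (Fin d → ℝ)} {s : ℝ} (hu : HasBoxUpper E s)
    (hl : HasBoxLower E s) : minkowskiDim E = (s : EReal) := by
  obtain ⟨C, hC, hu⟩ := hu
  obtain ⟨c, hc, hl⟩ := hl
  have hlog : Tendsto (fun ε : ℝ => Real.log (1 / ε)) (𝓝[>] 0) atTop := by
    simp only [one_div]
    exact Real.tendsto_log_atTop.comp tendsto_inv_nhdsGT_zero
  have hlim : ∀ K : ℝ, Tendsto (fun ε : ℝ => s + K / Real.log (1 / ε)) (𝓝[>] 0) (𝓝 s) := by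
    intro K
    simpa using (hlog.const_div_atTop K).const_add s
  have hsmall : ∀ᶠ ε : ℝ in 𝓝[>] 0, 0 < ε ∧ ε < 1 / 2 :=
    Ioo_mem_nhdsGT (by norm_num : (0 : ℝ) < 1 / 2)
  have hbounds : ∀ ε : ℝ, 0 < ε → ε < 1 / 2 →
      s + Real.log c / Real.log (1 / ε) ≤ Real.log (boxCount E ε) / Real.log (1 / ε) ∧
      Real.log (boxCount E ε) / Real.log (1 / ε) ≤ s + Real.log C / Real.log (1 / ε) := by
    intro ε h0 h1
    have hε : 1 < 1 / ε := by rw [lt_div_iff₀ h0]; linarith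
    have hL : 0 < Real.log (1 / ε) := Real.log_pos hε
    obtain ⟨P, hP, hEP⟩ := hu ε h0 (by linarith)
    obtain ⟨A, hA, hAE, hsep⟩ := hl ε h0 h1
    have hApos : (0 : ℝ) < A.card := lt_of_lt_of_le (by positivity) hA
    have hPne : P.Nonempty := by
      obtain ⟨x, hx⟩ := Finset.card_pos.1 (by exact_mod_cast hApos : 0 < A.card)
      obtain ⟨p, hp, -⟩ := Set.mem_iUnion₂.1 (hEP (hAE hx))
      exact ⟨p, hp⟩
    obtain ⟨h2, h3, a, ha⟩ := boxCount_le_card P hPne hEP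
    have h4 : (A.card : ℝ) ≤ boxCount E ε := by
      exact_mod_cast card_le_of_separated a ha A hAE hsep
    have h5 : (boxCount E ε : ℝ) ≤ C * (1 / ε) ^ s := le_trans (by exact_mod_cast h2) hP
    have h6 : ∀ K : ℝ, 0 < K → Real.log (K * (1 / ε) ^ s) = Real.log K + s * Real.log (1 / ε) := by
      intro K hK
      rw [Real.log_mul hK.ne' (by positivity), Real.log_rpow (by positivity)]
    have h7 : ∀ K : ℝ, s + K / Real.log (1 / ε) = (K + s * Real.log (1 / ε)) / Real.log (1 / ε) := by
      intro K
      field_simp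
      ring
    have h8 : (0 : ℝ) < boxCount E ε := by exact_mod_cast h3
    rw [h7, h7, ← h6 c hc, ← h6 C hC]
    constructor
    · gcongr
      exact hA.trans h4
    · gcongr
  have ht : Tendsto (fun ε : ℝ => Real.log (boxCount E ε) / Real.log (1 / ε)) (𝓝[>] 0) (𝓝 s) := by
    refine tendsto_of_tendsto_of_tendsto_of_le_of_le' (hlim (Real.log c)) (hlim (Real.log C)) ?_ ?_
    · filter_upwards [hsmall] with ε h
      exact (hbounds ε h.1 h.2).1
    · filter_upwards [hsmall] with ε h
      exact (hbounds ε h.1 h.2).2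
  exact ((continuous_coe_real_ereal.tendsto s).comp ht).limsup_eq

theorem hasBoxUpper_of_approx {d : ℕ} {E : Set (Fin d → ℝ)} {s A κ : ℝ} {W : ℕ} (hW : 2 ≤ W)
    (hs : 0 ≤ s) (hA : 0 < A) (hκ : 1 ≤ κ) (Z : ℕ → Finset (Fin d → ℝ))
    (hZ : ∀ j, ((Z j).card : ℝ) ≤ A * ((W : ℝ) ^ j) ^ s)
    (hE : ∀ y ∈ E, ∀ j, ∃ z ∈ Z j, ∀ i, |y i - z i| ≤ κ / (W : ℝ) ^ j) : HasBoxUpper E s := by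
  classical
  have hW' : (2 : ℝ) ≤ W := by exact_mod_cast hW
  refine ⟨A * (W * (2 * κ)) ^ s, by positivity, fun ε h0 h1 => ?_⟩
  have hx : 1 ≤ 2 * κ * (1 / ε) := by
    have : 1 ≤ 1 / ε := by rw [le_div_iff₀ h0]; linarith
    nlinarith
  -- Taking W^j ≤ 2κ/ε < W^(j+1), the cubes of radius κ / W^(j+1) have side at most ε; using level j
  -- + 1 costs only a bounded factor.
  obtain ⟨j, hj1, hj2⟩ := exists_nat_pow_near hx (by linarith : (1 : ℝ) < W)
  have hpos : (0 : ℝ) < (W : ℝ) ^ (j + 1) := by positivity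
  have hεj : 2 * (κ / (W : ℝ) ^ (j + 1)) ≤ ε := by
    rw [← mul_div_assoc, div_le_iff₀ hpos]
    rw [mul_one_div, div_lt_iff₀ h0] at hj2
    linarith
  refine ⟨(Z (j + 1)).image fun z i => z i - κ / (W : ℝ) ^ (j + 1), ?_, fun y hy => ?_⟩
  · calc ((((Z (j + 1)).image fun z i => z i - κ / (W : ℝ) ^ (j + 1)).card : ℕ) : ℝ)
        ≤ (Z (j + 1)).card := by exact_mod_cast Finset.card_image_le
      _ ≤ A * ((W : ℝ) ^ (j + 1)) ^ s := hZ _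
      _ ≤ A * ((W * (2 * κ)) * (1 / ε)) ^ s := by
          gcongr
          rw [pow_succ']
          calc (W : ℝ) * (W : ℝ) ^ j ≤ W * (2 * κ * (1 / ε)) := by gcongr
            _ = _ := by ring
      _ = _ := by rw [Real.mul_rpow (by positivity) (by positivity)]; ring
  · obtain ⟨z, hz, hyz⟩ := hE y hy (j + 1)
    refine Set.mem_iUnion₂.2 ⟨_, Finset.mem_image_of_mem _ hz, fun i => ?_, fun i => ?_⟩
    · have := (abs_le.1 (hyz i)).1
      simp only
      linarith
    · have := (abs_le.1 (hyz i)).2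
      simp only
      linarith

/-! ### A Cantor set of prescribed dimension -/

/-- The digits in the binary expansions of the points of `cantorGrid`: all of `{0, 1} ^ d` at a
proportion `θ` of the places, and only `0` elsewhere. -/
noncomputable def cantorDigits (d : ℕ) (θ : ℝ) (j : ℕ) : Finset (Fin d → ℤ) :=
  if ⌊θ * j⌋₊ < ⌊θ * (j + 1 : ℕ)⌋₊ then Fintype.piFinset fun _ => {0, 1} else {0}

open Classical in
/-- The integer vectors with `j` binary digits from `cantorDigits`. -/
noncomputable def cantorGrid (d : ℕ) (θ : ℝ) : ℕ → Finset (Fin d → ℤ)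
  | 0 => {0}
  | j + 1 => Finset.image₂ (fun a b => (2 : ℤ) • a + b) (cantorGrid d θ j) (cantorDigits d θ j)

theorem zero_mem_cantorDigits (d : ℕ) (θ : ℝ) (j : ℕ) : 0 ∈ cantorDigits d θ j := by
  unfold cantorDigits
  split_ifs <;> simp

theorem mem_cantorDigits {d : ℕ} {θ : ℝ} {j : ℕ} {b : Fin d → ℤ} (hb : b ∈ cantorDigits d θ j)
    (i : Fin d) : b i = 0 ∨ b i = 1 := by
  unfold cantorDigits at hb
  split_ifs at hb
  · simpa using Fintype.mem_piFinset.1 hb i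
  · simp [Finset.mem_singleton.1 hb]

/-- Digits are free exactly where ⌊θj⌋ jumps, and θ ≤ 1 limits each jump to 1, so the number of free
places telescopes. Uniqueness of binary digits makes the counts multiply. -/
theorem card_cantorGrid (d : ℕ) {θ : ℝ} (h0 : 0 ≤ θ) (h1 : θ ≤ 1) (j : ℕ) :
    (cantorGrid d θ j).card = 2 ^ (d * ⌊θ * j⌋₊) := by
  classical
  induction j with
  | zero => simp [cantorGrid]
  | succ j ih =>
    have hinj : Set.InjOn (fun p : (Fin d → ℤ) × (Fin d → ℤ) => (2 : ℤ) • p.1 + p.2)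
        (cantorGrid d θ j ×ˢ cantorDigits d θ j : Finset _) := by
      rintro ⟨a, b⟩ hab ⟨a', b'⟩ hab' h
      have hb := mem_cantorDigits (Finset.mem_product.1 hab).2
      have hb' := mem_cantorDigits (Finset.mem_product.1 hab').2
      have key : ∀ i, a i = a' i ∧ b i = b' i := by
        intro i
        have h2 := congrFun h i
        have h3 := hb i
        have h4 := hb' i
        simp only [Pi.add_apply, Pi.smul_apply, smul_eq_mul] at h2 h3 h4
        omega
      exact Prod.ext (funext fun i => (key i).1) (funext fun i => (key i).2)
    have hcard : (cantorGrid d θ (j + 1)).card =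
        (cantorGrid d θ j).card * (cantorDigits d θ j).card := by
      rw [cantorGrid, ← Finset.card_product]
      exact Finset.card_image_of_injOn hinj
    have hmono : ⌊θ * j⌋₊ ≤ ⌊θ * (j + 1 : ℕ)⌋₊ := by
      apply Nat.floor_le_floor
      push_cast
      nlinarith
    have hstep : ⌊θ * (j + 1 : ℕ)⌋₊ ≤ ⌊θ * j⌋₊ + 1 := by
      rw [← Nat.floor_add_one (by positivity)]
      apply Nat.floor_le_floor
      push_cast
      nlinarith
    rw [hcard, ih, cantorDigits]
    split_ifs with h
    · have : ⌊θ * (j + 1 : ℕ)⌋₊ = ⌊θ * j⌋₊ + 1 := by omega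
      rw [this, Fintype.card_piFinset]
      simp only [Finset.prod_const, Finset.card_univ, Fintype.card_fin]
      rw [Finset.card_pair (by norm_num), ← pow_add]
      ring_nf
    · have : ⌊θ * (j + 1 : ℕ)⌋₊ = ⌊θ * j⌋₊ := by omega
      rw [this]
      simp

/-- The points of `cantorGrid`, scaled to the unit cube. -/
def cantorPoints (d : ℕ) (θ : ℝ) : Set (Fin d → ℝ) :=
  {y | ∃ j, ∃ a ∈ cantorGrid d θ j, y = fun i => (a i : ℝ) / 2 ^ j}

theorem cantorGrid_refine {d : ℕ} {θ : ℝ} {J j : ℕ} (hJ : J ≤ j) {a : Fin d → ℤ}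
    (ha : a ∈ cantorGrid d θ J) :
    ∃ z ∈ cantorGrid d θ j, ∀ i, (a i : ℝ) / 2 ^ J = (z i : ℝ) / 2 ^ j := by
  classical
  induction j, hJ using Nat.le_induction with
  | base => exact ⟨a, ha, fun _ => rfl⟩
  | succ j _ ih =>
    obtain ⟨z, hz, h⟩ := ih
    refine ⟨_, Finset.mem_image₂_of_mem hz (zero_mem_cantorDigits d θ j), fun i => ?_⟩
    rw [h i, pow_succ]
    simp only [Pi.add_apply, Pi.smul_apply, smul_eq_mul, Pi.zero_apply, add_zero]
    push_cast
    field_simp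

/-- The dropped digits amount to at most the geometric sum of 2^(-i) for j < i ≤ J; keeping its
exact value lets the induction close. -/
theorem cantorGrid_truncate {d : ℕ} {θ : ℝ} {J j : ℕ} (hJ : j ≤ J) {a : Fin d → ℤ}
    (ha : a ∈ cantorGrid d θ J) :
    ∃ z ∈ cantorGrid d θ j, ∀ i, 0 ≤ (a i : ℝ) / 2 ^ J - (z i : ℝ) / 2 ^ j ∧
      (a i : ℝ) / 2 ^ J - (z i : ℝ) / 2 ^ j ≤ 1 / 2 ^ j - 1 / 2 ^ J := by
  classical
  induction J, hJ using Nat.le_induction generalizing a with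
  | base => exact ⟨a, ha, fun _ => by simp⟩
  | succ J _ ih =>
    obtain ⟨a', ha', b, hb, rfl⟩ := Finset.mem_image₂.1 ha
    obtain ⟨z, hz, h⟩ := ih ha'
    refine ⟨z, hz, fun i => ?_⟩
    have hexp : (((2 : ℤ) • a' + b) i : ℝ) / 2 ^ (J + 1) =
        (a' i : ℝ) / 2 ^ J + (b i : ℝ) * (1 / 2 ^ (J + 1)) := by
      simp only [Pi.add_apply, Pi.smul_apply, smul_eq_mul]
      push_cast
      rw [pow_succ]
      field_simp
    have hhalf : (1 : ℝ) / 2 ^ J = 2 * (1 / 2 ^ (J + 1)) := by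
      rw [pow_succ]
      field_simp
    have hpos : (0 : ℝ) < 1 / 2 ^ (J + 1) := by positivity
    obtain ⟨h1, h2⟩ := h i
    rw [hexp]
    rcases mem_cantorDigits hb i with hbi | hbi <;> rw [hbi] <;> push_cast <;>
      constructor <;> linarith

theorem hasBoxUpper_cantorPoints {d : ℕ} {θ : ℝ} (h0 : 0 ≤ θ) (h1 : θ ≤ 1) :
    HasBoxUpper (cantorPoints d θ) (d * θ) := by
  classical
  refine hasBoxUpper_of_approx (W := 2) (A := 1) (κ := 1) le_rfl (by positivity) one_pos le_rfl
    (fun j => (cantorGrid d θ j).image fun a i => (a i : ℝ) / 2 ^ j) (fun j => ?_) ?_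
  · refine (Nat.cast_le.2 Finset.card_image_le).trans ?_
    rw [card_cantorGrid d h0 h1, one_mul]
    push_cast
    rw [← Real.rpow_natCast, ← Real.rpow_natCast, ← Real.rpow_mul zero_le_two]
    refine Real.rpow_le_rpow_of_exponent_le one_le_two ?_
    push_cast
    have := Nat.floor_le (show 0 ≤ θ * j by positivity)
    calc (d : ℝ) * ⌊θ * j⌋₊ ≤ d * (θ * j) := by gcongr
      _ = _ := by ring
  · rintro y ⟨J, a, ha, rfl⟩ j
    push_cast
    rcases le_total J j with h | h
    · obtain ⟨z, hz, hza⟩ := cantorGrid_refine h ha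
      refine ⟨_, Finset.mem_image_of_mem _ hz, fun i => ?_⟩
      rw [hza i, sub_self, abs_zero]
      positivity
    · obtain ⟨z, hz, hza⟩ := cantorGrid_truncate h ha
      refine ⟨_, Finset.mem_image_of_mem _ hz, fun i => ?_⟩
      rw [abs_of_nonneg (hza i).1]
      have : (0 : ℝ) < 1 / 2 ^ J := by positivity
      linarith [(hza i).2]

theorem hasBoxLower_cantorPoints {d : ℕ} {θ : ℝ} (h0 : 0 ≤ θ) (h1 : θ ≤ 1) :
    HasBoxLower (cantorPoints d θ) (d * θ) := by
  classical
  -- With 2^j ≤ 1/(2ε) < 2^(j+1), distinct grid points are at least 2ε apart. The factor 2^(-d) pays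
  -- for the floor in the exponent and (1/4)^(dθ) for 2^j ≥ 1/(4ε).
  refine ⟨2 ^ (-(d : ℝ)) * (1 / 4 : ℝ) ^ (d * θ), by positivity, fun ε hε0 hε1 => ?_⟩
  have hx : 1 ≤ 1 / (2 * ε) := by rw [le_div_iff₀ (by positivity)]; linarith
  obtain ⟨j, hj1, hj2⟩ := exists_nat_pow_near hx (by norm_num : (1 : ℝ) < 2)
  have hpos : (0 : ℝ) < 2 ^ j := by positivity
  have hinj : Function.Injective fun (a : Fin d → ℤ) (i : Fin d) => (a i : ℝ) / 2 ^ j := by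
    intro a b hab
    funext i
    have := congrFun hab i
    simp only at this
    rw [div_left_inj' hpos.ne'] at this
    exact_mod_cast this
  refine ⟨(cantorGrid d θ j).image fun a i => (a i : ℝ) / 2 ^ j, ?_, ?_, ?_⟩
  · rw [Finset.card_image_of_injective _ hinj, card_cantorGrid d h0 h1]
    push_cast
    have h3 : (1 / 4 : ℝ) * (1 / ε) ≤ 2 ^ j := by
      rw [pow_succ] at hj2
      have : 1 / (2 * ε) = 1 / 2 * (1 / ε) := by field_simp
      rw [this] at hj2
      linarith
    calc 2 ^ (-(d : ℝ)) * (1 / 4 : ℝ) ^ (d * θ) * (1 / ε) ^ (d * θ)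
        = 2 ^ (-(d : ℝ)) * ((1 / 4 : ℝ) * (1 / ε)) ^ (d * θ) := by
          rw [Real.mul_rpow (by positivity) (by positivity)]; ring
      _ ≤ 2 ^ (-(d : ℝ)) * ((2 : ℝ) ^ j) ^ (d * θ) := by gcongr
      _ = 2 ^ (-(d : ℝ) + j * (d * θ)) := by
          rw [← Real.rpow_natCast, ← Real.rpow_mul zero_le_two, ← Real.rpow_add two_pos]
      _ ≤ 2 ^ ((d * ⌊θ * j⌋₊ : ℕ) : ℝ) := by
          refine Real.rpow_le_rpow_of_exponent_le one_le_two ?_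
          have := (Nat.lt_floor_add_one (θ * j)).le
          have h4 : (d : ℝ) * (θ * j) ≤ d * (⌊θ * j⌋₊ + 1) := by gcongr
          push_cast
          linarith
      _ = _ := Real.rpow_natCast _ _
  · intro y hy
    obtain ⟨a, ha, rfl⟩ := Finset.mem_image.1 (Finset.mem_coe.1 hy)
    exact ⟨j, a, ha, rfl⟩
  · intro y hy z hz hne
    obtain ⟨a, ha, rfl⟩ := Finset.mem_image.1 hy
    obtain ⟨b, hb, rfl⟩ := Finset.mem_image.1 hz
    have hab : a ≠ b := fun h => hne (by rw [h])
    obtain ⟨i, hi⟩ := Function.ne_iff.1 hab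
    refine ⟨i, ?_⟩
    have h5 : (1 : ℝ) ≤ |(a i : ℝ) - b i| := by
      have : 1 ≤ |a i - b i| := Int.one_le_abs (sub_ne_zero.2 hi)
      exact_mod_cast this
    rw [← sub_div, abs_div, abs_of_pos hpos, lt_div_iff₀ hpos]
    rw [le_div_iff₀ (by positivity)] at hj1
    nlinarith

/-! ### Real scaling factors and the continuous statement -/

namespace DigitSystem

variable {n : ℕ} {U : Finset (Fin n.totient → ℤ)} {s : ℝ}

/-- The approximation to the scaling factor of a real vector `x` from `j` digits of `x`. -/
noncomputable def realApprox (D : DigitSystem n U s) (x : Fin n.totient → ℝ) (j : ℕ) :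
    Fin n.totient → ℝ :=
  -- There are j digits after the point and one for the integer part, which the coordinate x i = 1
  -- requires.
  fun i => (D.factor (j + 1) (fun i => ⌊(D.W : ℝ) ^ j * x i⌋) i : ℝ) / (D.W : ℝ) ^ j

/-- Dividing ⌊W^(j+1) x⌋ by W recovers ⌊W^j x⌋, so consecutive approximants differ by a single
digit, of size at most W / W^(j+1). -/
theorem dist_realApprox_le (D : DigitSystem n U s) (x : Fin n.totient → ℝ) (j : ℕ) :
    dist (D.realApprox x j) (D.realApprox x (j + 1)) ≤ 1 * (1 / (D.W : ℝ)) ^ j := by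
  have hW : (0 : ℝ) < D.W := by exact_mod_cast D.W_pos
  rw [dist_pi_le_iff (by positivity)]
  intro i
  have hfloor : (fun i => ⌊(D.W : ℝ) ^ (j + 1) * x i⌋ / (D.W : ℤ)) =
      fun i => ⌊(D.W : ℝ) ^ j * x i⌋ := by
    funext i
    rw [← Int.floor_div_natCast]
    congr 1
    rw [pow_succ]
    field_simp
  set w := D.ρ (fun i => ⌊(D.W : ℝ) ^ (j + 1) * x i⌋ % (D.W : ℤ)) i with hw
  have hstep : D.realApprox x (j + 1) i = D.realApprox x j i + (w : ℝ) / (D.W : ℝ) ^ (j + 1) := by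
    rw [realApprox, factor, hfloor, realApprox]
    simp only [Pi.add_apply, Pi.smul_apply, smul_eq_mul]
    push_cast
    rw [← hw, pow_succ]
    field_simp
  have h1 : (1 : ℝ) ≤ w := by exact_mod_cast D.one_le_ρ _ i
  have h2 : (w : ℝ) ≤ D.W := by exact_mod_cast D.ρ_le _ i
  rw [hstep, dist_self_add_right, Real.norm_of_nonneg (by positivity), one_mul, one_div_pow,
    pow_succ, div_le_div_iff₀ (by positivity) (by positivity)]
  have : (0 : ℝ) < (D.W : ℝ) ^ j := by positivity
  nlinarith

theorem one_div_W_lt_one (D : DigitSystem n U s) : 1 / (D.W : ℝ) < 1 := by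
  have hW : (2 : ℝ) ≤ D.W := by exact_mod_cast D.two_le
  rw [div_lt_one (by linarith)]
  linarith

theorem exists_realFactor (D : DigitSystem n U s) (x : Fin n.totient → ℝ) :
    ∃ r : Fin n.totient → ℝ, Tendsto (D.realApprox x) atTop (𝓝 r) :=
  cauchySeq_tendsto_of_complete
    (cauchySeq_of_le_geometric _ _ D.one_div_W_lt_one (D.dist_realApprox_le x))

/-- The scaling factor of a real vector. -/
noncomputable def realFactor (D : DigitSystem n U s) (x : Fin n.totient → ℝ) :
    Fin n.totient → ℝ :=
  (D.exists_realFactor x).choose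

theorem dist_realFactor_le (D : DigitSystem n U s) (x : Fin n.totient → ℝ) (j : ℕ) :
    dist (D.realApprox x j) (D.realFactor x) ≤ 2 / (D.W : ℝ) ^ j := by
  have hW : (2 : ℝ) ≤ D.W := by exact_mod_cast D.two_le
  refine (dist_le_of_le_geometric_of_tendsto _ _ D.one_div_W_lt_one (D.dist_realApprox_le x)
    (D.exists_realFactor x).choose_spec j).trans ?_
  have h1 : 1 / (D.W : ℝ) ≤ 1 / 2 := by gcongr
  rw [one_mul, one_div_pow, div_le_iff₀ (by linarith), div_mul_eq_mul_div]
  gcongr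
  linarith

theorem one_le_realFactor (D : DigitSystem n U s) (x : Fin n.totient → ℝ) (i : Fin n.totient) :
    1 ≤ D.realFactor x i := by
  have hW : (0 : ℝ) < D.W := by exact_mod_cast D.W_pos
  refine ge_of_tendsto' (((tendsto_pi_nhds.1 (D.exists_realFactor x).choose_spec) i))
    fun j => ?_
  rw [realApprox, le_div_iff₀ (by positivity), one_mul]
  exact_mod_cast D.pow_le_factor j _ i

/-- The points `x + realFactor x ⊗ u` with `x` in the unit cube. -/
def realValues (D : DigitSystem n U s) (u : Fin n.totient → ℤ) : Set (Fin n.totient → ℝ) :=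
  {y | ∃ x : Fin n.totient → ℝ, (∀ i, x i ∈ Set.Icc (0 : ℝ) 1) ∧
    y = x + cycloMul n (D.realFactor x) (fun i => (u i : ℝ))}

/-- At scale W^(-j), truncation moves x by at most W^(-j) and r by at most 2W^(-j). Multiplication
by u is a bounded linear map L, so rescaled integer values approximate the set within (1 + 2‖L‖)
W^(-j). -/
theorem hasBoxUpper_realValues (D : DigitSystem n U s) (hs : 0 ≤ s) {u : Fin n.totient → ℤ}
    (hu : u ∈ U) : HasBoxUpper (D.realValues u) s := by
  classical
  have hW : (2 : ℝ) ≤ D.W := by exact_mod_cast D.two_le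
  have hW0 : (0 : ℝ) < D.W := by linarith
  set L := LinearMap.toContinuousLinearMap (cycloLin n fun i => (u i : ℝ)) with hL
  refine hasBoxUpper_of_approx (W := D.W) (A := (D.W : ℝ) ^ s) (κ := 1 + 2 * ‖L‖) D.two_le hs
    (by positivity) (by linarith [norm_nonneg L])
    (fun j => (D.values u (j + 1)).image fun z i => (z i : ℝ) / (D.W : ℝ) ^ j) (fun j => ?_) ?_
  · refine (Nat.cast_le.2 Finset.card_image_le).trans ((D.card_values_le hu (j + 1)).trans ?_)
    rw [pow_succ', Real.mul_rpow (by positivity) (by positivity)]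
  · rintro y ⟨x, hx, rfl⟩ j
    have hpos : (0 : ℝ) < (D.W : ℝ) ^ j := by positivity
    refine ⟨_, Finset.mem_image_of_mem _ (D.add_factor_mem_values hu (j + 1)
      (fun i => ⌊(D.W : ℝ) ^ j * x i⌋) fun i => ⟨?_, ?_⟩), fun i => ?_⟩
    · exact Int.floor_nonneg.2 (mul_nonneg hpos.le (hx i).1)
    · rw [Int.floor_lt]
      push_cast
      rw [pow_succ]
      have := (hx i).2
      nlinarith
    · have h1 : |x i - (⌊(D.W : ℝ) ^ j * x i⌋ : ℝ) / (D.W : ℝ) ^ j| ≤ 1 / (D.W : ℝ) ^ j := by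
        have h2 := Int.floor_le ((D.W : ℝ) ^ j * x i)
        have h3 := Int.lt_floor_add_one ((D.W : ℝ) ^ j * x i)
        have h4 : x i - (⌊(D.W : ℝ) ^ j * x i⌋ : ℝ) / (D.W : ℝ) ^ j =
            ((D.W : ℝ) ^ j * x i - ⌊(D.W : ℝ) ^ j * x i⌋) / (D.W : ℝ) ^ j := by field_simp
        rw [h4, abs_div, abs_of_pos hpos]
        gcongr
        rw [abs_le]
        constructor <;> linarith
      have h5 : ((cycloMul n (D.factor (j + 1) fun i => ⌊(D.W : ℝ) ^ j * x i⌋) u i : ℤ) : ℝ) /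
          (D.W : ℝ) ^ j = L (D.realApprox x j) i := by
        have h6 : D.realApprox x j = ((D.W : ℝ) ^ j)⁻¹ • fun i =>
            ((D.factor (j + 1) (fun i => ⌊(D.W : ℝ) ^ j * x i⌋) i : ℤ) : ℝ) := by
          funext i
          rw [realApprox, Pi.smul_apply, smul_eq_mul, div_eq_inv_mul]
        rw [h6, map_smul, hL, LinearMap.coe_toContinuousLinearMap', cycloLin_apply,
          cycloMul_intCast, Pi.smul_apply, smul_eq_mul, div_eq_inv_mul]
      have h7 : |L (D.realFactor x) i - L (D.realApprox x j) i| ≤ ‖L‖ * (2 / (D.W : ℝ) ^ j) := by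
        have h8 := norm_le_pi_norm (L (D.realFactor x - D.realApprox x j)) i
        rw [map_sub, Pi.sub_apply, Real.norm_eq_abs, ← map_sub] at h8
        refine h8.trans ((L.le_opNorm _).trans ?_)
        gcongr
        rw [← dist_eq_norm, dist_comm]
        exact D.dist_realFactor_le x j
      have h9 : cycloMul n (D.realFactor x) (fun i => (u i : ℝ)) i = L (D.realFactor x) i := rfl
      simp only [Pi.add_apply]
      push_cast
      rw [h9, add_div, h5, add_sub_add_comm]
      calc _ ≤ 1 / (D.W : ℝ) ^ j + ‖L‖ * (2 / (D.W : ℝ) ^ j) :=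
            (abs_add_le _ _).trans (add_le_add h1 h7)
        _ = _ := by ring

theorem exists_compact (D : DigitSystem n U s) (hn : 0 < n) (hs : 0 ≤ s)
    (hsd : s ≤ n.totient) :
    ∃ F : Set (Fin n.totient → ℝ), IsCompact F ∧
      (∀ x : Fin n.totient → ℝ, (∀ i, x i ∈ Set.Icc (0 : ℝ) 1) → ContainsPattern n U F x) ∧
      minkowskiDim F = (s : EReal) := by
  have hd : (0 : ℝ) < n.totient := by exact_mod_cast Nat.totient_pos.2 hn
  set θ := s / n.totient with hθ
  have h0 : 0 ≤ θ := by positivity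
  have h1 : θ ≤ 1 := (div_le_one hd).2 hsd
  have hθs : (n.totient : ℝ) * θ = s := mul_div_cancel₀ _ hd.ne'
  -- The pattern points are only known to have dimension at most s; the Cantor set with θ = s/d
  -- supplies the matching lower bound without spoiling the upper one.
  have hup := (HasBoxUpper.biUnion U D.realValues fun u hu => D.hasBoxUpper_realValues hs hu).union
    (hθs ▸ hasBoxUpper_cantorPoints (d := n.totient) h0 h1)
  have hlow : HasBoxLower (cantorPoints n.totient θ) s :=
    hθs ▸ hasBoxLower_cantorPoints (d := n.totient) h0 h1
  refine ⟨_, hup.isCompact_closure, fun x hx => ⟨D.realFactor x, fun h => ?_, fun u hu => ?_⟩,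
    minkowskiDim_eq_of_bounds hup.closure
      (hlow.mono (Set.subset_union_right.trans subset_closure))⟩
  · have h2 := D.one_le_realFactor x ⟨0, Nat.totient_pos.2 hn⟩
    rw [h, Pi.zero_apply] at h2
    norm_num at h2
  · exact subset_closure (Or.inl (Set.mem_iUnion₂.2 ⟨u, hu, x, hx, rfl⟩))

end DigitSystem

theorem eventually_exists_compact {n : ℕ} (hn : 0 < n) (U : ℕ → Finset (Fin n.totient → ℤ))
    (hcard : ∀ k, (U k).card = k) (hU : ∀ k, ∀ u ∈ U k, ∀ i, u i ≠ 0)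
    (hg : ∃ g : ℕ → ℝ, g =o[atTop] (fun k : ℕ => (k : ℝ)) ∧
      ∀ k, ∀ u ∈ U k, ∀ i, |(u i : ℝ)| ≤ (2 : ℝ) ^ g k) :
    ∀ᶠ k : ℕ in atTop,
      ∃ F : Set (Fin n.totient → ℝ), IsCompact F ∧
        (∀ x : Fin n.totient → ℝ, (∀ i, x i ∈ Set.Icc (0 : ℝ) 1) → ContainsPattern n (U k) F x) ∧
        minkowskiDim F = (((n.totient : ℝ) - (1 / 30) / Real.log k : ℝ) : EReal) := by
  filter_upwards [eventually_digitSystem hn U hcard hU hg, eventually_exponent_nonneg hn]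
    with k ⟨D⟩ ⟨hlog, hs⟩
  exact D.exists_compact hn hs (sub_le_self _ (by positivity))

theorem pos_of_two_four_or_prime_pow {n : ℕ} (hn : n = 2 ∨ n = 4 ∨
    ∃ p m : ℕ, p.Prime ∧ p ≠ 2 ∧ 1 ≤ m ∧ (n = p ^ m ∨ n = 2 * p ^ m)) : 0 < n := by
  rcases hn with rfl | rfl | ⟨p, m, hp, -, -, rfl | rfl⟩
  · norm_num
  · norm_num
  · exact pow_pos hp.pos m
  · exact mul_pos two_pos (pow_pos hp.pos m)

theorem mainTheorem7 :
    -- discrete statement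
    (∃ c : ℝ, 0 < c ∧
      ∀ n : ℕ,
        (n = 2 ∨ n = 4 ∨ ∃ p m : ℕ, p.Prime ∧ p ≠ 2 ∧ 1 ≤ m ∧ (n = p ^ m ∨ n = 2 * p ^ m)) →
      ∀ U : ℕ → Finset (Fin n.totient → ℤ),
        (∀ k, (U k).card = k) →
        (∀ k, ∀ u ∈ U k, ∀ i, u i ≠ 0) →
        (∃ g : ℕ → ℝ, g =o[atTop] (fun k : ℕ => (k : ℝ)) ∧
          ∀ k, ∀ u ∈ U k, ∀ i, |(u i : ℝ)| ≤ (2 : ℝ) ^ g k) →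
        ∀ᶠ k : ℕ in atTop, ∀ᶠ N : ℕ in atTop,
          ∃ B : Finset (Fin n.totient → ℤ),
            (∀ x : Fin n.totient → ℤ, (∀ i, x i ∈ Finset.Icc (1 : ℤ) N) →
              ContainsPattern n (U k) (B : Set (Fin n.totient → ℤ)) x) ∧
            (B.card : ℝ) < (N : ℝ) ^ ((n.totient : ℝ) - c / Real.log k)) ∧
    -- continuous statement
    (∃ c : ℝ, 0 < c ∧
      ∀ n : ℕ,
        (n = 2 ∨ n = 4 ∨ ∃ p m : ℕ, p.Prime ∧ p ≠ 2 ∧ 1 ≤ m ∧ (n = p ^ m ∨ n = 2 * p ^ m)) →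
      ∀ U : ℕ → Finset (Fin n.totient → ℤ),
        (∀ k, (U k).card = k) →
        (∀ k, ∀ u ∈ U k, ∀ i, u i ≠ 0) →
        (∃ g : ℕ → ℝ, g =o[atTop] (fun k : ℕ => (k : ℝ)) ∧
          ∀ k, ∀ u ∈ U k, ∀ i, |(u i : ℝ)| ≤ (2 : ℝ) ^ g k) →
        ∀ᶠ k : ℕ in atTop,
          ∃ F : Set (Fin n.totient → ℝ), IsCompact F ∧
            (∀ x : Fin n.totient → ℝ, (∀ i, x i ∈ Set.Icc (0 : ℝ) 1) →
              ContainsPattern n (U k) F x) ∧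
            minkowskiDim F = (((n.totient : ℝ) - c / Real.log k : ℝ) : EReal)) ∧
    -- arithmetic progressions
    (∃ c : ℝ, 0 < c ∧ ∀ k : ℕ, 2 ≤ k → ∀ᶠ N : ℕ in atTop,
      (gPrime k N : ℝ) ≤ (N : ℝ) ^ (1 - c / Real.log k)) := by
  refine ⟨⟨1 / 60, by norm_num, fun n hn U hcard hU hg => ?_⟩,
    ⟨1 / 30, by norm_num, fun n hn U hcard hU hg => ?_⟩, exists_gPrime_le⟩
  · exact eventually_exists_small_finset (pos_of_two_four_or_prime_pow hn) U hcard hU hg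
  · exact eventually_exists_compact (pos_of_two_four_or_prime_pow hn) U hcard hU hg
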